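/- Let $n>1$ and let $P(\rho,S)$ be a smooth function of $\rho>0$ and $S\in\mathbb R$. Consider compressible fluid flow in $\mathbb R^n$ with velocity $\mathbf u$, density $\rho>0$ and entropy per unit mass $S$, governed by $$\partial_t\mathbf u+\mathbf u\cdot\nabla\mathbf u+\tfrac1\rho\nabla p=0,\qquad \partial_t\rho+\nabla\cdot(\rho\mathbf u)=0,\qquad \partial_tS+\mathbf u\cdot\nabla S=0,\qquad p=P(\rho,S).$$ The flow is called non-isentropic if $\partial P/\partial S\not\equiv0$ and $S$ is an arbitrary dynamical variable; it is called isentropic if $p=P(\rho)$ does not depend on $S$, or if $S$ is constant throughout the fluid. A local function is a smooth function of $t,\mathbf x,\mathbf u,\rho>0,S$ and finitely many $\mathbf x$-derivatives of $\mathbf u,\rho,S$; $D_{\mathbf x}$ denotes the total spatial derivative, and $\mathcal D_t$ the total time derivative in which the time derivatives of $\mathbf u,\rho,S$ are replaced by means of the flow equations. A moving-boundary constant of motion is an integral $\oint_{\partial V(t)}\boldsymbol\Theta\cdot\hat{\mathbf n}\,d^{n-1}\sigma$ over the boundary of arbitrary domains $V(t)$ transported by the fluid, where $\boldsymbol\Theta$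 is a local vector function that is not identically divergence-free, and which is constant in time formally for all solutions; that is, $T=\operatorname{div}\boldsymbol\Theta=D_{\mathbf x}\cdot\boldsymbol\Theta\not\equiv0$ satisfies the local continuity equation $$\mathcal D_tT+D_{\mathbf x}\cdot(\mathbf u\,T)=0 .$$ Put $\omega^{ij}=\tfrac12(\partial_ju^i-\partial_iu^j)$ and let $\epsilon$ be the orientation (Levi-Civita) tensor. Define $$\varpi=\epsilon^{i_1j_1\cdots i_mj_m}\omega_{i_1j_1}\cdots\omega_{i_mj_m}\ (n=2m),\qquad \varpi^i=\epsilon^{ij_1k_1\cdots j_mk_m}\omega_{j_1k_1}\cdots\omega_{j_mk_m}\ (n=2m+1).$$ The density $T$ is of vorticity form if $T=F(\rho,S,\mathbf u,\varpi)$ for $n=2m$, or $T=F(\rho,S,\mathbf u,\boldsymbol\varpi)$ with $\boldsymbol\varpi=(\varpi^i)$ for $n=2m+1$, with $F$ a smooth function. (i) For non-isentropic flow there is no moving-boundary constant of motion whose density $T=\operatorname{div}\boldsymbol\Theta$ is of vorticity form. (ii) For isentropic flow in even dimensions $n=2m$, the generalized circulation $$\oint_{\partial V(t)}(\mathbf u\wedge\boldsymbol\omega^{m-1})\cdot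 d\mathbf A=\oint_{\partial V(t)}\boldsymbol\Theta_0\cdot\hat{\mathbf n}\,d^{n-1}\sigma,\qquad \Theta_0^i=\epsilon^{iji_1j_1\cdots i_{m-1}j_{m-1}}\,u_j\,\omega_{i_1j_1}\cdots\omega_{i_{m-1}j_{m-1}},$$ is a moving-boundary constant of motion whose density is of vorticity form, and it is the only one up to a constant factor: for any other such $\boldsymbol\Theta$ there is a constant $c\neq0$ such that $\boldsymbol\Theta-c\,\boldsymbol\Theta_0$ is identically divergence-free. For isentropic flow in odd dimensions $n>1$ there is none. -/

import Mathlib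

open scoped ContDiff Topology

noncomputable section

namespace Fluid

/-- Points of `ℝⁿ` in Cartesian coordinates (also used for vectors). -/
abbrev Space (n : ℕ) : Type := Fin n → ℝ

/-- Values `(u, ρ, S)` of the fluid variables: velocity, density, entropy per unit mass. -/
abbrev Phase (n : ℕ) : Type := Space n × ℝ × ℝ

/-- The fluid fields `x ↦ (u(x), ρ(x), S(x))` at one instant of time. -/
abbrev Fields (n : ℕ) : Type := Space n → Phase n

variable {n : ℕ}

def velocity (U : Fields n) (x : Space n) : Space n := (U x).1

def density (U : Fields n) (x : Space n) : ℝ := (U x).2.1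

def entropy (U : Fields n) (x : Space n) : ℝ := (U x).2.2

/-- The partial derivative `∂f/∂xⁱ`. -/
def partialDeriv (i : Fin n) (f : Space n → ℝ) (x : Space n) : ℝ :=
  fderiv ℝ f x (Pi.single i 1)

/-- The divergence `∑ᵢ ∂Yⁱ/∂xⁱ`. -/
def divergence (Y : Space n → Space n) (x : Space n) : ℝ :=
  ∑ i, partialDeriv i (fun y => Y y i) x

/-! ### The flow equations -/

/-- `P(ρ, S)` is smooth on `ρ > 0`. -/
def IsEquationOfState (P : ℝ → ℝ → ℝ) : Prop :=
  ContDiffOn ℝ ∞ (fun q : ℝ × ℝ => P q.1 q.2) {q | 0 < q.1}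

/-- `∂P/∂S` does not vanish identically. -/
def IsNonisentropic (P : ℝ → ℝ → ℝ) : Prop :=
  ∃ ρ S : ℝ, 0 < ρ ∧ deriv (P ρ) S ≠ 0

/-- The time derivatives `(∂ₜu, ∂ₜρ, ∂ₜS)` prescribed by
`∂ₜu + u·∇u + ρ⁻¹∇p = 0`, `∂ₜρ + ∇·(ρu) = 0`, `∂ₜS + u·∇S = 0` with `p = P(ρ, S)`. -/
def eulerRHS (P : ℝ → ℝ → ℝ) (U : Fields n) : Fields n := fun x =>
  (fun i =>
      -(∑ j, velocity U x j * partialDeriv j (fun y => velocity U y i) x)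
        - (density U x)⁻¹ * partialDeriv i (fun y => P (density U y) (entropy U y)) x,
    -divergence (fun y => density U y • velocity U y) x,
    -∑ j, velocity U x j * partialDeriv j (entropy U) x)

/-- The fields `U` are smooth near `x`, with positive density at `x` (hence near `x`). -/
def IsRegularAt (U : Fields n) (x : Space n) : Prop :=
  (∀ᶠ y in 𝓝 x, ContDiffAt ℝ ∞ U y) ∧ 0 < density U x

/-- As `IsRegularAt`, with the entropy equal to the constant `s₀` near `x`. -/
def IsConstEntropyAt (s₀ : ℝ) (U : Fields n) (x : Space n) : Prop :=
  IsRegularAt U x ∧ ∀ᶠ y in 𝓝 x, entropy U y = s₀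

/-- Isentropic flow: either `p = P(ρ)` does not depend on the entropy, or the entropy is
constant throughout the fluid. The predicate `𝒜` tells which local fields are considered. -/
def IsIsentropicFlow (P : ℝ → ℝ → ℝ) (𝒜 : Fields n → Space n → Prop) : Prop :=
  (𝒜 = IsRegularAt ∧ ∃ p : ℝ → ℝ, ∀ ρ S : ℝ, 0 < ρ → P ρ S = p ρ) ∨
    ∃ s₀ : ℝ, 𝒜 = IsConstEntropyAt s₀

/-! ### Local functions and total derivatives -/

/-- The values of the spatial derivatives of `(u, ρ, S)` of orders `1, …, k` at a point. -/
abbrev Derivs (n k : ℕ) : Type := ∀ j : Fin k, Space n [×(j.1 + 1)]→L[ℝ] Phase n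

/-- `Θ(t, x)[U]` is a smooth function of `t, x, u, ρ, S` (with `ρ > 0`) and finitely many
`x`-derivatives of `u, ρ, S`, evaluated at the fields `U` and the point `x`. -/
def IsLocalVector (𝒜 : Fields n → Space n → Prop)
    (Θ : ℝ → Fields n → Space n → Space n) : Prop :=
  ∃ (k : ℕ) (L : ℝ × Space n × Phase n × Derivs n k → Space n),
    ContDiffOn ℝ ∞ L {q | 0 < q.2.2.1.2.1} ∧
      ∀ t U x, 𝒜 U x →
        Θ t U x = L (t, x, U x, fun j => iteratedFDeriv ℝ (j.1 + 1) U x)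

/-- The total spatial divergence `div Θ = D_x · Θ`. -/
def totalDiv (Θ : ℝ → Fields n → Space n → Space n) : ℝ → Fields n → Space n → ℝ :=
  fun t U x => divergence (Θ t U) x

/-- The total time derivative `𝒟ₜT` evaluated on solutions: the derivative of `T` along the
velocity `∂ₜU = eulerRHS P U` of the fields. (`T` involves no time derivatives of the fields.) -/
def evolDeriv (P : ℝ → ℝ → ℝ) (T : ℝ → Fields n → Space n → ℝ) :
    ℝ → Fields n → Space n → ℝ :=
  fun t U x => deriv (fun s : ℝ => T (t + s) (U + s • eulerRHS P U) x) 0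

/-- The continuity equation `𝒟ₜT + D_x · (u T) = 0` for a density `T` whose integral over every
domain moving with the fluid is constant in time, holding formally for all solutions. -/
def HasZeroMovingFlux (P : ℝ → ℝ → ℝ) (𝒜 : Fields n → Space n → Prop)
    (T : ℝ → Fields n → Space n → ℝ) : Prop :=
  ∀ t U x, 𝒜 U x →
    evolDeriv P T t U x + divergence (fun y => T t U y • velocity U y) x = 0

/-- `Θ` is a local vector function which is not identically divergence-free and whose integrals
`∮ Θ · n̂` over the boundaries of domains moving with the fluid are constant in time, which is
expressed by the continuity equation of the density `T = div Θ`. -/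
def IsMovingBoundaryCOM (P : ℝ → ℝ → ℝ) (𝒜 : Fields n → Space n → Prop)
    (Θ : ℝ → Fields n → Space n → Space n) : Prop :=
  IsLocalVector 𝒜 Θ ∧
    (∃ t U x, 𝒜 U x ∧ totalDiv Θ t U x ≠ 0) ∧
    HasZeroMovingFlux P 𝒜 (totalDiv Θ)

/-! ### Vorticity -/

/-- The curl `ω^{ij} = ½ (∂ⱼuⁱ - ∂ᵢuʲ)`. -/
def curl (U : Fields n) (x : Space n) (i j : Fin n) : ℝ :=
  (partialDeriv j (fun y => velocity U y i) x - partialDeriv i (fun y => velocity U y j) x) / 2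

/-- For `n = 2m`, the vorticity scalar `ϖ = ∗(ω^m) = ε^{i₁j₁⋯iₘjₘ} ω_{i₁j₁}⋯ω_{iₘjₘ}`;
the sum over the indices is written as a sum over the permutations `σ = (i₁j₁⋯iₘjₘ)`. -/
def vorticityScalar (U : Fields n) (x : Space n) : ℝ :=
  ∑ σ : Equiv.Perm (Fin n), ((Equiv.Perm.sign σ : ℤ) : ℝ) *
    ∏ k : Fin (n / 2),
      curl U x (σ ⟨2 * k.1, by have := k.2; omega⟩) (σ ⟨2 * k.1 + 1, by have := k.2; omega⟩)

/-- For `n = 2m + 1`, the vorticity vector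
`ϖ^i = ∗(ω^m)^i = ε^{i j₁k₁⋯jₘkₘ} ω_{j₁k₁}⋯ω_{jₘkₘ}`. -/
def vorticityVector (U : Fields n) (x : Space n) : Space n := fun i =>
  ∑ σ : Equiv.Perm (Fin n) with (σ.symm i).1 = 0, ((Equiv.Perm.sign σ : ℤ) : ℝ) *
    ∏ k : Fin ((n - 1) / 2),
      curl U x (σ ⟨2 * k.1 + 1, by have := k.2; omega⟩) (σ ⟨2 * k.1 + 2, by have := k.2; omega⟩)

/-- For `n = 2m`, the tensor
`w^{ij} = ∗(ω^{m-1})^{ij} = ε^{ij i₁j₁⋯} ω_{i₁j₁}⋯` (with `m - 1` factors `ω`). -/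
def vorticityTensor (U : Fields n) (x : Space n) (i j : Fin n) : ℝ :=
  ∑ σ : Equiv.Perm (Fin n) with (σ.symm i).1 = 0 ∧ (σ.symm j).1 = 1,
    ((Equiv.Perm.sign σ : ℤ) : ℝ) *
    ∏ k : Fin ((n - 2) / 2),
      curl U x (σ ⟨2 * k.1 + 2, by have := k.2; omega⟩) (σ ⟨2 * k.1 + 3, by have := k.2; omega⟩)

/-- `T` is of vorticity form: a smooth function of `ρ > 0`, `S`, `u` and the vorticity scalar
(`n` even) or vorticity vector (`n` odd). -/
def HasVorticityForm (𝒜 : Fields n → Space n → Prop)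
    (T : ℝ → Fields n → Space n → ℝ) : Prop :=
  (Even n ∧ ∃ F : ℝ × ℝ × Space n × ℝ → ℝ, ContDiffOn ℝ ∞ F {q | 0 < q.1} ∧
      ∀ t U x, 𝒜 U x →
        T t U x = F (density U x, entropy U x, velocity U x, vorticityScalar U x)) ∨
    (Odd n ∧ ∃ F : ℝ × ℝ × Space n × Space n → ℝ, ContDiffOn ℝ ∞ F {q | 0 < q.1} ∧
      ∀ t U x, 𝒜 U x →
        T t U x = F (density U x, entropy U x, velocity U x, vorticityVector U x))

/-- For `n = 2m`, the vector function `Θ^i = w^{ij} uⱼ` of the generalized circulation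
`∮ Θ · n̂ dσ = ∮ (u ∧ ω^{m-1}) · dA` with `dA = ∗n̂ dσ`. -/
def circulation (_t : ℝ) (U : Fields n) (x : Space n) : Space n := fun i =>
  ∑ j, vorticityTensor U x i j * velocity U x j

end Fluid

end

/-!
A density of vorticity form is a function `F` of `(ρ, S, u, ϖ)`. Since `T = div Θ` is a total
divergence, its integral does not change under compactly supported perturbations of the fields, so
the first variation of `∫ F` about affine fields vanishes. Perturbing `ρ` shows that `F` does not
depend on `ρ`, and then the continuity equation at a rotating, isotropically expanding flow makes
`F` homogeneous of degree `n / 2` in the vorticity tensor `ω`. For `n = 2m` this means that `F` is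
linear in `ϖ`, and perturbing `u` and `S` shows that the coefficient is constant: `T = c ϖ`. For odd
`n`, the function `F` at vorticity `r² ω` is smooth in `r`, even, and homogeneous of odd degree `n`,
hence zero.

Conversely `div Θ₀ = -ϖ`, because the 2-form `ω` is closed. The flux of `ϖ` is the derivative of the
Pfaffian along the curl of `ρ⁻¹ ∇p`, which is the baroclinic torque `∇ρ ∧ ∇S`. It vanishes for
isentropic flow, and for `∂P/∂S ≢ 0` a suitable stratified affine field makes it nonzero.
-/

noncomputable section

namespace Fluid

variable {n : ℕ}

/-! ### The Pfaffian -/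

section Pfaffian

open Equiv

variable {ι κ R : Type*} [Fintype ι] [Fintype κ] [CommRing R]

/-- The bilinear form with matrix `M` as a multilinear form in two vectors indexed by `Bool`. -/
def matrixForm (M : ι → ι → R) : MultilinearMap R (fun _ : Bool => ι → R) R :=
  ∑ i, ∑ j, M i j • (MultilinearMap.mkPiAlgebra R Bool R).compLinearMap
    fun b => LinearMap.proj (cond b j i)

theorem matrixForm_apply (M : ι → ι → R) (v : Bool → ι → R) :
    matrixForm M v = ∑ i, ∑ j, v false i * M i j * v true j := by
  simp only [matrixForm, _root_.sum_apply, _root_.smul_apply,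
    MultilinearMap.compLinearMap_apply, MultilinearMap.mkPiAlgebra_apply, Fintype.prod_bool,
    LinearMap.proj_apply, cond_true, cond_false, smul_eq_mul]
  exact Finset.sum_congr rfl fun i _ => Finset.sum_congr rfl fun j _ => by ring

variable [DecidableEq ι]

/-- The sum `∑ sign σ ∏ₖ M_{σ(e(k,0)) σ(e(k,1))}` over the permutations `σ` of the index set, which
is `2ᵐ m!` times the Pfaffian of an antisymmetric `M` of size `2m`. The equivalence `e` arranges
the indices in pairs. -/
def pfaffian (e : κ × Bool ≃ ι) (M : ι → ι → R) : R :=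
  ∑ σ : Perm ι, ((Perm.sign σ : ℤ) : R) * ∏ k, M (σ (e (k, false))) (σ (e (k, true)))

/-- The multilinear form `v ↦ ∏ₖ M(v_{e(k,0)}, v_{e(k,1)})`, whose alternatization computes the
Pfaffian. -/
def pairingForm (e : κ × Bool ≃ ι) (M : ι → ι → R) :
    MultilinearMap R (fun _ : ι => ι → R) R :=
  ((MultilinearMap.mkPiAlgebra R κ R).compMultilinearMap fun _ => matrixForm M).domDomCongr
    ((sigmaEquivProd κ Bool).trans e)

theorem alternatization_pairingForm (e : κ × Bool ≃ ι) (A M : ι → ι → R) :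
    MultilinearMap.alternatization (pairingForm e M) (fun j i => A i j) =
      pfaffian e fun i j => ∑ k, ∑ l, A k i * M k l * A l j := by
  simp only [MultilinearMap.alternatization_apply, pfaffian, Units.smul_def, zsmul_eq_mul]
  refine Finset.sum_congr rfl fun σ _ => congrArg _ (Finset.prod_congr rfl fun k _ => ?_)
  exact matrixForm_apply M _

theorem pfaffian_congruence (e : κ × Bool ≃ ι) (A M : ι → ι → R) :
    (pfaffian e fun i j => ∑ k, ∑ l, A k i * M k l * A l j) =
      (Matrix.of A).det * pfaffian e M := by
  have hone : pfaffian e M =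
      MultilinearMap.alternatization (pairingForm e M) (Pi.basisFun R ι) := by
    have h := alternatization_pairingForm e (fun i j => (Pi.basisFun R ι) j i) M
    refine Eq.trans (congrArg _ (funext₂ fun i j => ?_)) h.symm
    simp [Pi.single_apply]
  have hdet := DFunLike.congr_fun (AlternatingMap.eq_smul_basis_det (Pi.basisFun R ι)
    (MultilinearMap.alternatization (pairingForm e M))) fun j i => A i j
  rw [AlternatingMap.smul_apply, Pi.basisFun_det_apply, smul_eq_mul] at hdet
  rw [← alternatization_pairingForm, hone, hdet, ← Matrix.det_transpose, mul_comm]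
  rfl

theorem pfaffian_smul (e : κ × Bool ≃ ι) (c : R) (M : ι → ι → R) :
    pfaffian e (c • M) = c ^ Fintype.card κ * pfaffian e M := by
  simp only [pfaffian, Pi.smul_apply, smul_eq_mul, Finset.prod_mul_distrib, Finset.prod_const,
    Finset.card_univ, Finset.mul_sum]
  exact Finset.sum_congr rfl fun σ _ => by ring

theorem contDiff_pfaffian (e : κ × Bool ≃ ι) {k : WithTop ℕ∞} :
    ContDiff ℝ k (pfaffian e : (ι → ι → ℝ) → ℝ) := by
  unfold pfaffian
  exact ContDiff.sum fun σ _ => contDiff_const.mul (contDiff_prod fun k _ => by fun_prop)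

theorem hasFDerivAt_pfaffian (e : κ × Bool ≃ ι) (M : ι → ι → ℝ) :
    HasFDerivAt (pfaffian e) (fderiv ℝ (pfaffian e) M) M :=
  ((contDiff_pfaffian e (k := 1)).differentiable one_ne_zero M).hasFDerivAt

theorem hasDerivAt_det_one_add_smul (A : Matrix ι ι ℝ) :
    HasDerivAt (fun ε : ℝ => (1 + ε • A).det) A.trace 0 := by
  have heval (ε : ℝ) : (1 + ε • A).det =
      ((1 + (Polynomial.X : Polynomial ℝ) • A.map Polynomial.C).det).eval ε := by
    rw [← Polynomial.coe_evalRingHom, RingHom.map_det]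
    congr 1
    ext i j
    simp [Matrix.one_apply, apply_ite (Polynomial.eval ε), mul_comm ε]
  rw [funext heval, ← Matrix.derivative_det_one_add_X_smul]
  exact Polynomial.hasDerivAt _ 0

/-- The derivative `AᵀM + MA` at `ε = 0` of the congruences `(1 + εA)ᵀ M (1 + εA)`; for a velocity
gradient `A`, this is how the flow deforms a two-form `M` that it transports. -/
def infinitesimalCongruence (A M : ι → ι → ℝ) (i j : ι) : ℝ :=
  ∑ k, (A k i * M k j + M i k * A k j)

theorem fderiv_pfaffian_infinitesimalCongruence (e : κ × Bool ≃ ι) (A M : ι → ι → ℝ) :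
    fderiv ℝ (pfaffian e) M (infinitesimalCongruence A M) = (∑ i, A i i) * pfaffian e M := by
  set B : ℝ → ι → ι → ℝ := fun ε => (1 : Matrix ι ι ℝ) + ε • Matrix.of A with hB
  have hB' (k l : ι) : HasDerivAt (fun ε => B ε k l) (A k l) 0 := by
    simpa [hB] using ((hasDerivAt_id (0 : ℝ)).mul_const (A k l)).const_add
      ((1 : Matrix ι ι ℝ) k l)
  have hcurve : HasDerivAt (fun ε i j => ∑ k, ∑ l, B ε k i * M k l * B ε l j)
      (infinitesimalCongruence A M) 0 := by
    refine hasDerivAt_pi.2 fun i => hasDerivAt_pi.2 fun j => ?_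
    refine (HasDerivAt.fun_sum fun k _ => HasDerivAt.fun_sum fun l _ =>
      ((hB' k i).mul_const (M k l)).mul (hB' l j)).congr_deriv ?_
    simp only [infinitesimalCongruence, hB, zero_smul, add_zero, Finset.sum_add_distrib]
    refine congrArg₂ _ ?_ (Finset.sum_comm.trans ?_) <;> simp [Matrix.one_apply]
  have hcurve₀ : (fun i j => ∑ k, ∑ l, B 0 k i * M k l * B 0 l j) = M := by
    funext i j
    simp [hB, Matrix.one_apply]
  have hcomp := (hasFDerivAt_pfaffian e M).comp_hasDerivAt_of_eq 0 hcurve hcurve₀.symm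
  have hdet := (hasDerivAt_det_one_add_smul (Matrix.of A)).mul_const (pfaffian e M)
  refine hcomp.unique (hdet.congr_of_eventuallyEq (.of_forall fun ε => ?_))
  exact pfaffian_congruence e (B ε) M

end Pfaffian

/-! ### Antisymmetric forms with prescribed Pfaffian -/

section BlockForm

open Equiv

theorem exists_eq_prodCongrLeft_mul_prodCongrRight {α β : Type*} [Finite α] [Finite β] [Nonempty β]
    (τ : Perm (α × β)) (hτ : ∀ a b b', (τ (a, b)).1 = (τ (a, b')).1) :
    ∃ (π : Perm α) (φ : α → Perm β), τ = prodCongrLeft (fun _ => π) * prodCongrRight φ := by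
  obtain ⟨b₀⟩ := ‹Nonempty β›
  have hπ : Function.Surjective fun a => (τ (a, b₀)).1 := fun a' => by
    obtain ⟨⟨a, b⟩, hab⟩ := τ.surjective (a', b₀)
    exact ⟨a, (hτ a b₀ b).trans (congrArg Prod.fst hab)⟩
  have hφ (a : α) : Function.Injective fun b => (τ (a, b)).2 := fun b b' hbb' =>
    congrArg Prod.snd (τ.injective (Prod.ext (hτ a b b') hbb'))
  refine ⟨Equiv.ofBijective _ (Finite.surjective_iff_bijective.1 hπ),
    fun a => Equiv.ofBijective _ (Finite.injective_iff_bijective.1 (hφ a)), ?_⟩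
  ext1 ⟨a, b⟩
  exact Prod.ext (hτ a b b₀) rfl

variable {ι κ : Type*} [DecidableEq κ]

/-- The standard symplectic form on `ℝ^κ ⊗ ℝ²`. -/
def stdForm (p q : κ × Bool) : ℝ :=
  if p.1 = q.1 then (if q.2 then 1 else 0) - (if p.2 then 1 else 0) else 0

theorem stdForm_antisymm (p q : κ × Bool) : stdForm q p = -stdForm p q := by
  by_cases h : p.1 = q.1
  · simp [stdForm, h]
  · simp [stdForm, h, Ne.symm h]

theorem stdForm_perm (k : κ) (φ : Perm Bool) :
    stdForm (k, φ false) (k, φ true) = ((Perm.sign φ : ℤ) : ℝ) := by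
  have hφ : φ = 1 ∨ φ = swap false true := by
    revert φ
    decide
  rcases hφ with rfl | rfl <;> simp [stdForm]

theorem sign_mul_prod_stdForm_nonneg [Fintype κ] (τ : Perm (κ × Bool)) :
    0 ≤ ((Perm.sign τ : ℤ) : ℝ) * ∏ k, stdForm (τ (k, false)) (τ (k, true)) := by
  by_cases h : ∀ k, (τ (k, false)).1 = (τ (k, true)).1
  · obtain ⟨π, φ, rfl⟩ := exists_eq_prodCongrLeft_mul_prodCongrRight τ
      (by rintro k (_ | _) (_ | _) <;> simp [h k])
    set τ : Perm (κ × Bool) := prodCongrLeft (fun _ => π) * prodCongrRight φ with hτ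
    have hform (k : κ) : stdForm (τ (k, false)) (τ (k, true)) = ((Perm.sign (φ k) : ℤ) : ℝ) :=
      stdForm_perm (π k) (φ k)
    have hsign : Perm.sign τ = ∏ k, Perm.sign (φ k) := by
      simp [hτ, Perm.sign_prodCongrLeft, Perm.sign_prodCongrRight]
    simp only [hform, hsign, Units.coe_prod, Int.cast_prod]
    exact mul_self_nonneg _
  · obtain ⟨k, hk⟩ := not_forall.1 h
    rw [Finset.prod_eq_zero (Finset.mem_univ k) (if_neg hk), mul_zero]

/-- The antisymmetric form consisting of blocks `[[0, cₖ], [-cₖ, 0]]`. -/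
def blockForm (e : κ × Bool ≃ ι) (c : κ → ℝ) (i j : ι) : ℝ :=
  c (e.symm i).1 * stdForm (e.symm i) (e.symm j)

theorem blockForm_antisymm (e : κ × Bool ≃ ι) (c : κ → ℝ) (i j : ι) :
    blockForm e c j i = -blockForm e c i j := by
  by_cases h : (e.symm i).1 = (e.symm j).1
  · rw [blockForm, blockForm, stdForm_antisymm, mul_neg, h]
  · simp [blockForm, stdForm, h, Ne.symm h]

theorem blockForm_update (e : κ × Bool ≃ ι) (c : κ → ℝ) (k : κ) (r : ℝ) :
    blockForm e (Function.update c k r) =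
      blockForm e (Function.update c k 0) + r • blockForm e (Pi.single k 1) := by
  funext i j
  by_cases h : (e.symm i).1 = k <;> simp [blockForm, h]

/-- The exterior product of two vectors as an antisymmetric form. -/
def wedge {ι : Type*} (a b : ι → ℝ) (i j : ι) : ℝ := a i * b j - a j * b i

variable [DecidableEq ι]

theorem blockForm_single (e : κ × Bool ≃ ι) (k : κ) :
    blockForm e (Pi.single k 1) =
      wedge (Pi.single (e (k, false)) 1) (Pi.single (e (k, true)) 1) := by
  funext i j
  obtain ⟨⟨k, a⟩, rfl⟩ := e.surjective i
  obtain ⟨⟨l, b⟩, rfl⟩ := e.surjective j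
  cases a <;> cases b <;> simp [blockForm, stdForm, wedge, Pi.single_apply] <;> grind

variable [Fintype ι] [Fintype κ]

theorem pfaffian_blockForm_one_pos (e : κ × Bool ≃ ι) : 0 < pfaffian e (blockForm e 1) := by
  have hterm (σ : Perm ι) : ((Perm.sign σ : ℤ) : ℝ) *
        ∏ k, blockForm e 1 (σ (e (k, false))) (σ (e (k, true))) =
      ((Perm.sign (e.symm.permCongr σ) : ℤ) : ℝ) *
        ∏ k, stdForm (e.symm.permCongr σ (k, false)) (e.symm.permCongr σ (k, true)) := by
    simp [blockForm, Perm.sign_permCongr, permCongr_apply]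
  refine Finset.sum_pos' (fun σ _ => ?_) ⟨1, Finset.mem_univ _, ?_⟩
  · exact (sign_mul_prod_stdForm_nonneg _).trans_eq (hterm σ).symm
  · simp [blockForm, stdForm]

theorem pfaffian_blockForm (e : κ × Bool ≃ ι) (c : κ → ℝ) :
    pfaffian e (blockForm e c) = (∏ k, c k) * pfaffian e (blockForm e 1) := by
  set d : ι → ℝ := fun i => if (e.symm i).2 then 1 else c (e.symm i).1 with hd
  have hdet : (Matrix.of fun i j => if i = j then d i else 0).det = ∏ k, c k := by
    refine (Matrix.det_diagonal (d := d)).trans ?_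
    rw [← e.prod_comp, Fintype.prod_prod_type]
    simp [hd]
  rw [← hdet, ← pfaffian_congruence]
  refine congrArg _ (funext₂ fun i j => ?_)
  have hsum : ∑ k, ∑ l, (if k = i then d k else 0) * blockForm e 1 k l *
      (if l = j then d l else 0) = d i * blockForm e 1 i j * d j := by
    simp
  rw [hsum]
  by_cases h : (e.symm i).1 = (e.symm j).1
  · rcases hi : (e.symm i).2 <;> rcases hj : (e.symm j).2 <;>
      simp [blockForm, stdForm, hd, h, hi, hj]
  · simp [blockForm, stdForm, h]

theorem fderiv_pfaffian_blockForm (e : κ × Bool ≃ ι) (k : κ) :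
    fderiv ℝ (pfaffian e) (blockForm e (Function.update 1 k 0)) (blockForm e (Pi.single k 1)) =
      pfaffian e (blockForm e 1) := by
  have hcurve : HasDerivAt (fun r : ℝ => blockForm e (Function.update 1 k r))
      (blockForm e (Pi.single k 1)) 0 := by
    rw [funext (blockForm_update e 1 k)]
    simpa using ((hasDerivAt_id (0 : ℝ)).smul_const (blockForm e (Pi.single k 1))).const_add
      (blockForm e (Function.update 1 k 0))
  have hcomp := (hasFDerivAt_pfaffian e _).comp_hasDerivAt (0 : ℝ) hcurve
  have hlin (r : ℝ) : pfaffian e (blockForm e (Function.update 1 k r)) =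
      r * pfaffian e (blockForm e 1) := by
    rw [pfaffian_blockForm, Finset.prod_update_of_mem (Finset.mem_univ k)]
    simp
  have hd := (hasDerivAt_id (0 : ℝ)).mul_const (pfaffian e (blockForm e 1))
  rw [one_mul] at hd
  exact hcomp.unique (hd.congr_of_eventuallyEq (.of_forall hlin))

end BlockForm

theorem exists_pfaffian_eq {ι κ : Type*} [Fintype ι] [DecidableEq ι] [Fintype κ] [Nonempty κ]
    (e : κ × Bool ≃ ι) (w : ℝ) :
    ∃ M : ι → ι → ℝ, (∀ i j, M j i = -M i j) ∧ pfaffian e M = w := by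
  classical
  obtain ⟨k⟩ := ‹Nonempty κ›
  refine ⟨blockForm e (Function.update 1 k (w / pfaffian e (blockForm e 1))),
    blockForm_antisymm _ _, ?_⟩
  rw [pfaffian_blockForm, Finset.prod_update_of_mem (Finset.mem_univ k)]
  simp [(pfaffian_blockForm_one_pos e).ne']

/-! ### The vorticity scalar and vector as functions of the curl -/

/-- The indices `2k` and `2k + 1` form the `k`-th pair. -/
def pairEquiv (hn : Even n) : Fin (n / 2) × Bool ≃ Fin n where
  toFun p := ⟨2 * p.1.1 + p.2.toNat, by have := p.1.2; have := p.2.toNat_le; omega⟩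
  invFun i := (⟨i.1 / 2, by have := i.2; have := hn.two_dvd; omega⟩, decide (i.1 % 2 = 1))
  left_inv := by
    rintro ⟨k, _ | _⟩ <;> ext <;> simp; omega
  right_inv i := by
    ext
    rcases Nat.mod_two_eq_zero_or_one i.1 with h | h <;> simp [h] <;> omega

theorem vorticityScalar_eq_pfaffian (hn : Even n) (U : Fields n) (x : Space n) :
    vorticityScalar U x = pfaffian (pairEquiv hn) (curl U x) := rfl

/-- The components `ε^{i j₁k₁⋯jₘkₘ} M_{j₁k₁}⋯M_{jₘkₘ}` for `n = 2m + 1`. -/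
def pfaffianVec (M : Fin n → Fin n → ℝ) : Space n := fun i =>
  ∑ σ : Equiv.Perm (Fin n) with (σ.symm i).1 = 0, ((Equiv.Perm.sign σ : ℤ) : ℝ) *
    ∏ k : Fin ((n - 1) / 2),
      M (σ ⟨2 * k.1 + 1, by have := k.2; omega⟩) (σ ⟨2 * k.1 + 2, by have := k.2; omega⟩)

theorem contDiff_pfaffianVec {k : WithTop ℕ∞} : ContDiff ℝ k (pfaffianVec (n := n)) := by
  unfold pfaffianVec
  exact contDiff_pi.2 fun i => ContDiff.sum fun σ _ =>
    contDiff_const.mul (contDiff_prod fun k _ => by fun_prop)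

theorem pfaffianVec_smul (c : ℝ) (M : Fin n → Fin n → ℝ) :
    pfaffianVec (c • M) = c ^ ((n - 1) / 2) • pfaffianVec M := by
  funext i
  simp only [pfaffianVec, Pi.smul_apply, smul_eq_mul, Finset.prod_mul_distrib, Finset.prod_const,
    Finset.card_univ, Fintype.card_fin, Finset.mul_sum]
  exact Finset.sum_congr rfl fun σ _ => by ring

/-! ### Partial derivatives -/

section PartialDeriv

variable {f g : Space n → ℝ} {Y Z : Space n → Space n} {x : Space n}

theorem partialDeriv_of_hasFDerivAt {f' : Space n →L[ℝ] ℝ} (h : HasFDerivAt f f' x) (i : Fin n) :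
    partialDeriv i f x = f' (Pi.single i 1) := by
  rw [partialDeriv, h.fderiv]

theorem partialDeriv_congr (h : f =ᶠ[𝓝 x] g) (i : Fin n) :
    partialDeriv i f x = partialDeriv i g x := by
  rw [partialDeriv, partialDeriv, h.fderiv_eq]

theorem partialDeriv_const (c : ℝ) (x : Space n) (i : Fin n) :
    partialDeriv i (fun _ => c) x = 0 := by
  simp [partialDeriv]

theorem partialDeriv_coord (x : Space n) (i j : Fin n) :
    partialDeriv i (fun y => y j) x = (Pi.single j 1 : Space n) i := by
  rw [partialDeriv_of_hasFDerivAt (hasFDerivAt_apply j x), ContinuousLinearMap.proj_apply,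
    Pi.single_comm]

theorem partialDeriv_add (hf : DifferentiableAt ℝ f x) (hg : DifferentiableAt ℝ g x) (i : Fin n) :
    partialDeriv i (fun y => f y + g y) x = partialDeriv i f x + partialDeriv i g x :=
  partialDeriv_of_hasFDerivAt (hf.hasFDerivAt.fun_add hg.hasFDerivAt) i

theorem partialDeriv_sub (hf : DifferentiableAt ℝ f x) (hg : DifferentiableAt ℝ g x) (i : Fin n) :
    partialDeriv i (fun y => f y - g y) x = partialDeriv i f x - partialDeriv i g x :=
  partialDeriv_of_hasFDerivAt (hf.hasFDerivAt.fun_sub hg.hasFDerivAt) i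

theorem partialDeriv_neg (i : Fin n) : partialDeriv i (fun y => -f y) x = -partialDeriv i f x := by
  simp [partialDeriv, fderiv_fun_neg]

theorem partialDeriv_mul (hf : DifferentiableAt ℝ f x) (hg : DifferentiableAt ℝ g x) (i : Fin n) :
    partialDeriv i (fun y => f y * g y) x =
      f x * partialDeriv i g x + partialDeriv i f x * g x := by
  rw [partialDeriv_of_hasFDerivAt (hf.hasFDerivAt.fun_mul hg.hasFDerivAt)]
  simp [partialDeriv, mul_comm]

theorem partialDeriv_const_mul (hf : DifferentiableAt ℝ f x) (c : ℝ) (i : Fin n) :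
    partialDeriv i (fun y => c * f y) x = c * partialDeriv i f x := by
  rw [partialDeriv_mul (differentiableAt_const c) hf, partialDeriv_const, zero_mul, add_zero]

theorem partialDeriv_sum {ι : Type*} {s : Finset ι} {f : ι → Space n → ℝ}
    (hf : ∀ k ∈ s, DifferentiableAt ℝ (f k) x) (i : Fin n) :
    partialDeriv i (fun y => ∑ k ∈ s, f k y) x = ∑ k ∈ s, partialDeriv i (f k) x := by
  rw [partialDeriv_of_hasFDerivAt (HasFDerivAt.fun_sum fun k hk => (hf k hk).hasFDerivAt)]
  simp [partialDeriv]

theorem contDiffAt_partialDeriv (hf : ContDiffAt ℝ ∞ f x) (i : Fin n) :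
    ContDiffAt ℝ ∞ (partialDeriv i f) x :=
  (hf.fderiv_right (m := ∞) (by simp)).clm_apply contDiffAt_const

theorem partialDeriv_comm (hf : ContDiffAt ℝ ∞ f x) (i j : Fin n) :
    partialDeriv i (partialDeriv j f) x = partialDeriv j (partialDeriv i f) x := by
  have hd : DifferentiableAt ℝ (fderiv ℝ f) x :=
    (hf.fderiv_right (m := ∞) (by simp)).differentiableAt (by simp)
  have hsecond (a b : Fin n) : partialDeriv a (partialDeriv b f) x =
      fderiv ℝ (fderiv ℝ f) x (Pi.single a 1) (Pi.single b 1) :=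
    (partialDeriv_of_hasFDerivAt
      (hd.hasFDerivAt.clm_apply (hasFDerivAt_const (Pi.single b 1) x)) a).trans (by simp)
  rw [hsecond, hsecond]
  have hle : minSmoothness ℝ 2 ≤ ∞ := by
    rw [minSmoothness_of_isRCLikeNormedField]
    exact WithTop.coe_le_coe.2 le_top
  exact (hf.isSymmSndFDerivAt hle).eq _ _

theorem fderiv_apply_eq_sum {E : Type*} [NormedAddCommGroup E] [NormedSpace ℝ E]
    (f : Space n → E) (x v : Space n) :
    fderiv ℝ f x v = ∑ i, v i • fderiv ℝ f x (Pi.single i 1) := by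
  conv_lhs => rw [pi_eq_sum_univ' v, map_sum]
  simp only [map_smul, Pi.single]

/-! ### Gradients, Jacobian matrices and divergences -/

/-- The gradient of a function. -/
def grad (f : Space n → ℝ) (x : Space n) : Space n := fun i => partialDeriv i f x

/-- The matrix of partial derivatives `∂Yⁱ/∂xʲ` of a vector field. -/
def jacobian (Y : Space n → Space n) (x : Space n) (i j : Fin n) : ℝ :=
  partialDeriv j (fun y => Y y i) x

/-- The antisymmetric part of a matrix. -/
def antisymmPart (A : Fin n → Fin n → ℝ) (i j : Fin n) : ℝ := (A i j - A j i) / 2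

theorem curl_eq_antisymmPart (U : Fields n) (x : Space n) :
    curl U x = antisymmPart (jacobian (velocity U) x) := rfl

theorem antisymmPart_eq_self {M : Fin n → Fin n → ℝ} (hM : ∀ i j, M j i = -M i j) :
    antisymmPart M = M := by
  funext i j
  rw [antisymmPart, hM i j]
  ring

theorem fderiv_apply_eq_jacobian (hY : DifferentiableAt ℝ Y x) (v : Space n) (i : Fin n) :
    fderiv ℝ Y x v i = ∑ j, jacobian Y x i j * v j := by
  rw [show fderiv ℝ Y x v i = fderiv ℝ (fun y => Y y i) x v by rw [fderiv_apply hY]; rfl,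
    fderiv_apply_eq_sum]
  exact Finset.sum_congr rfl fun j _ => mul_comm _ _

theorem jacobian_add (hY : DifferentiableAt ℝ Y x) (hZ : DifferentiableAt ℝ Z x) :
    jacobian (Y + Z) x = jacobian Y x + jacobian Z x :=
  funext₂ fun i j => partialDeriv_add (differentiableAt_pi.1 hY i) (differentiableAt_pi.1 hZ i) j

theorem jacobian_const_smul (hY : DifferentiableAt ℝ Y x) (c : ℝ) :
    jacobian (c • Y) x = c • jacobian Y x :=
  funext₂ fun i j => partialDeriv_const_mul (differentiableAt_pi.1 hY i) c j

theorem jacobian_const (c x : Space n) : jacobian (fun _ => c) x = 0 :=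
  funext₂ fun i j => partialDeriv_const (c i) x j

theorem divergence_smul (hf : DifferentiableAt ℝ f x) (hY : DifferentiableAt ℝ Y x) :
    divergence (fun y => f y • Y y) x = fderiv ℝ f x (Y x) + f x * divergence Y x := by
  rw [fderiv_apply_eq_sum, divergence, divergence, Finset.mul_sum, ← Finset.sum_add_distrib]
  refine Finset.sum_congr rfl fun i _ => ?_
  rw [add_comm, smul_eq_mul, mul_comm (Y x i)]
  exact partialDeriv_mul hf (differentiableAt_pi.1 hY i) i

theorem divergence_congr (h : Y =ᶠ[𝓝 x] Z) : divergence Y x = divergence Z x :=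
  Finset.sum_congr rfl fun i _ => partialDeriv_congr (h.fun_comp (· i)) i

theorem divergence_sub (hY : DifferentiableAt ℝ Y x) (hZ : DifferentiableAt ℝ Z x) :
    divergence (fun y => Y y - Z y) x = divergence Y x - divergence Z x := by
  rw [divergence, divergence, divergence, ← Finset.sum_sub_distrib]
  exact Finset.sum_congr rfl fun i _ =>
    partialDeriv_sub (differentiableAt_pi.1 hY i) (differentiableAt_pi.1 hZ i) i

theorem antisymmPart_jacobian_smul (hf : DifferentiableAt ℝ f x) (hY : DifferentiableAt ℝ Y x) :
    antisymmPart (jacobian (fun y => f y • Y y) x) =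
      f x • antisymmPart (jacobian Y x) + (2⁻¹ : ℝ) • wedge (Y x) (grad f x) := by
  have hmul (i j : Fin n) : jacobian (fun y => f y • Y y) x i j =
      f x * jacobian Y x i j + grad f x j * Y x i :=
    partialDeriv_mul hf (differentiableAt_pi.1 hY i) j
  funext i j
  simp only [antisymmPart, hmul, wedge, Pi.add_apply, Pi.smul_apply, smul_eq_mul]
  ring

theorem antisymmPart_jacobian_grad (hf : ContDiffAt ℝ ∞ f x) :
    antisymmPart (jacobian (grad f) x) = 0 := by
  funext i j
  simp only [antisymmPart, jacobian, grad, partialDeriv_comm hf j i, sub_self, zero_div,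
    Pi.zero_apply]

end PartialDeriv

/-! ### Fields and flow classes -/

section Fields

variable {𝒜 : Fields n → Space n → Prop} {P : ℝ → ℝ → ℝ} {U V : Fields n} {x : Space n}

theorem isOpen_pos_fst {E : Type*} [TopologicalSpace E] : IsOpen {q : ℝ × E | 0 < q.1} :=
  isOpen_lt continuous_const continuous_fst

theorem contDiffAt_velocity (hU : ContDiffAt ℝ ∞ U x) : ContDiffAt ℝ ∞ (velocity U) x :=
  contDiffAt_fst.comp x hU

theorem contDiffAt_density (hU : ContDiffAt ℝ ∞ U x) : ContDiffAt ℝ ∞ (density U) x :=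
  (contDiffAt_fst.comp (U x) contDiffAt_snd).comp x hU

theorem contDiffAt_entropy (hU : ContDiffAt ℝ ∞ U x) : ContDiffAt ℝ ∞ (entropy U) x :=
  (contDiffAt_snd.comp (U x) contDiffAt_snd).comp x hU

theorem contDiffAt_curl (hU : ContDiffAt ℝ ∞ U x) : ContDiffAt ℝ ∞ (curl U) x :=
  have hu := contDiffAt_pi.1 (contDiffAt_velocity hU)
  contDiffAt_pi.2 fun i => contDiffAt_pi.2 fun j =>
    ((contDiffAt_partialDeriv (hu i) j).sub (contDiffAt_partialDeriv (hu j) i)).div_const 2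

theorem curl_add_smul (hU : DifferentiableAt ℝ (velocity U) x)
    (hV : DifferentiableAt ℝ (velocity V) x) (ε : ℝ) :
    curl (U + ε • V) x = curl U x + ε • curl V x := by
  have hjac : jacobian (velocity (U + ε • V)) x =
      jacobian (velocity U) x + ε • jacobian (velocity V) x :=
    (jacobian_add hU (hV.const_smul ε)).trans (by rw [jacobian_const_smul hV])
  funext i j
  simp only [curl_eq_antisymmPart, hjac, antisymmPart, Pi.add_apply, Pi.smul_apply, smul_eq_mul]
  ring

theorem partialDeriv_curl (hU : ContDiffAt ℝ ∞ U x) (k i j : Fin n) :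
    partialDeriv k (fun y => curl U y i j) x =
      (partialDeriv k (partialDeriv j fun y => velocity U y i) x -
        partialDeriv k (partialDeriv i fun y => velocity U y j) x) / 2 := by
  have hd (i j) : DifferentiableAt ℝ (partialDeriv j fun y => velocity U y i) x :=
    (contDiffAt_partialDeriv (contDiffAt_pi.1 (contDiffAt_velocity hU) i) j).differentiableAt
      (by simp)
  simp only [curl, div_eq_inv_mul]
  rw [partialDeriv_const_mul ((hd i j).fun_sub (hd j i)), partialDeriv_sub (hd i j) (hd j i)]

theorem IsRegularAt.contDiffAt (hU : IsRegularAt U x) : ContDiffAt ℝ ∞ U x := hU.1.self_of_nhds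

theorem IsRegularAt.eventually (hU : IsRegularAt U x) : ∀ᶠ y in 𝓝 x, IsRegularAt U y := by
  filter_upwards [hU.1.eventually_nhds,
    (contDiffAt_density hU.contDiffAt).continuousAt.eventually (lt_mem_nhds hU.2)]
    with y h1 h2 using ⟨h1, h2⟩

/-- The two classes of fields to which the conservation laws refer: all regular fields, or those
with a given constant entropy. -/
def IsFlowClass (𝒜 : Fields n → Space n → Prop) : Prop :=
  𝒜 = IsRegularAt ∨ ∃ s, 𝒜 = IsConstEntropyAt s

theorem IsIsentropicFlow.isFlowClass (h : IsIsentropicFlow P 𝒜) : IsFlowClass 𝒜 :=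
  h.imp_left And.left

theorem IsFlowClass.isRegularAt (h𝒜 : IsFlowClass 𝒜) (hU : 𝒜 U x) : IsRegularAt U x := by
  rcases h𝒜 with rfl | ⟨s, rfl⟩
  exacts [hU, hU.1]

theorem IsFlowClass.eventually (h𝒜 : IsFlowClass 𝒜) (hU : 𝒜 U x) : ∀ᶠ y in 𝓝 x, 𝒜 U y := by
  rcases h𝒜 with rfl | ⟨s, rfl⟩
  · exact hU.eventually
  · exact hU.1.eventually.and hU.2.eventually_nhds

theorem IsFlowClass.exists_isConstEntropyAt (h𝒜 : IsFlowClass 𝒜) :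
    ∃ s, ∀ U x, IsConstEntropyAt s U x → 𝒜 U x := by
  rcases h𝒜 with rfl | ⟨s, rfl⟩
  exacts [⟨0, fun _ _ h => h.1⟩, ⟨s, fun _ _ h => h⟩]

end Fields

/-! ### The forces and the vorticity equation -/

section Flow

variable {𝒜 : Fields n → Space n → Prop} {P : ℝ → ℝ → ℝ} {U : Fields n} {x : Space n}

/-- The pressure field `p = P(ρ, S)`. -/
def pressure (P : ℝ → ℝ → ℝ) (U : Fields n) (x : Space n) : ℝ := P (density U x) (entropy U x)

/-- The pressure force per unit mass `ρ⁻¹∇p`, with the sign it has in the Euler equations. -/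
def force (P : ℝ → ℝ → ℝ) (U : Fields n) (x : Space n) : Space n :=
  (density U x)⁻¹ • grad (pressure P U) x

theorem contDiffAt_pressure (hP : IsEquationOfState P) (hU : IsRegularAt U x) :
    ContDiffAt ℝ ∞ (pressure P U) x :=
  ContDiffAt.comp x (hP.contDiffAt (isOpen_pos_fst.mem_nhds hU.2))
    ((contDiffAt_density hU.contDiffAt).prodMk (contDiffAt_entropy hU.contDiffAt))

theorem contDiffAt_grad {f : Space n → ℝ} (hf : ContDiffAt ℝ ∞ f x) :
    ContDiffAt ℝ ∞ (grad f) x :=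
  contDiffAt_pi.2 fun i => contDiffAt_partialDeriv hf i

theorem contDiffAt_force (hP : IsEquationOfState P) (hU : IsRegularAt U x) :
    ContDiffAt ℝ ∞ (force P U) x :=
  ((contDiffAt_density hU.contDiffAt).inv hU.2.ne').smul
    (contDiffAt_grad (contDiffAt_pressure hP hU))

theorem grad_pressure (hP : IsEquationOfState P) (hU : IsRegularAt U x) :
    grad (pressure P U) x =
      deriv (fun r => P r (entropy U x)) (density U x) • grad (density U) x +
        deriv (P (density U x)) (entropy U x) • grad (entropy U) x := by
  set ρ := density U x
  set s := entropy U x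
  set D := fderiv ℝ (fun q : ℝ × ℝ => P q.1 q.2) (ρ, s)
  have hPd : HasFDerivAt (fun q : ℝ × ℝ => P q.1 q.2) D (ρ, s) :=
    ((hP.contDiffAt (isOpen_pos_fst.mem_nhds hU.2)).differentiableAt (by simp)).hasFDerivAt
  have hρ : deriv (fun r => P r s) ρ = D (1, 0) :=
    (hPd.comp_hasDerivAt (f := fun r => (r, s)) ρ
      ((hasDerivAt_id ρ).prodMk (hasDerivAt_const ρ s))).deriv
  have hs : deriv (P ρ) s = D (0, 1) :=
    (hPd.comp_hasDerivAt (f := fun r => (ρ, r)) s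
      ((hasDerivAt_const s ρ).prodMk (hasDerivAt_id s))).deriv
  have hd := ((contDiffAt_density hU.contDiffAt).differentiableAt (by simp)).hasFDerivAt
  have he := ((contDiffAt_entropy hU.contDiffAt).differentiableAt (by simp)).hasFDerivAt
  funext i
  have hchain := partialDeriv_of_hasFDerivAt (hPd.comp x (hd.prodMk he)) i
  refine hchain.trans ?_
  rw [ContinuousLinearMap.comp_apply, ContinuousLinearMap.prod_apply, hρ, hs, Pi.add_apply,
    Pi.smul_apply, Pi.smul_apply, smul_eq_mul, smul_eq_mul, mul_comm, mul_comm _ (grad _ x i),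
    ← smul_eq_mul, ← smul_eq_mul, ← map_smul, ← map_smul, ← map_add]
  simp [grad, partialDeriv]

/-- The baroclinic torque: only the misalignment of `∇ρ` and `∇S` creates vorticity. -/
theorem antisymmPart_jacobian_force (hP : IsEquationOfState P) (hU : IsRegularAt U x) :
    antisymmPart (jacobian (force P U) x) =
      (deriv (P (density U x)) (entropy U x) * (density U x)⁻¹ ^ 2 / 2) •
        wedge (grad (density U) x) (grad (entropy U) x) := by
  have hd := (contDiffAt_density hU.contDiffAt).differentiableAt (n := ∞) (by simp)
  have hp := contDiffAt_pressure hP hU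
  have hinv : grad (fun y => (density U y)⁻¹) x =
      (-(density U x)⁻¹ ^ 2) • grad (density U) x := by
    funext i
    refine (partialDeriv_of_hasFDerivAt
      ((hasDerivAt_inv hU.2.ne').comp_hasFDerivAt x hd.hasFDerivAt) i).trans ?_
    simp [grad, partialDeriv]
  refine (antisymmPart_jacobian_smul (hd.fun_inv hU.2.ne')
    ((contDiffAt_grad hp).differentiableAt (by simp))).trans ?_
  rw [antisymmPart_jacobian_grad hp, hinv, grad_pressure hP hU, smul_zero, zero_add]
  funext i j
  simp only [wedge, Pi.add_apply, Pi.smul_apply, smul_eq_mul]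
  ring

theorem antisymmPart_jacobian_force_of_isIsentropicFlow (hP : IsEquationOfState P)
    (h𝒜 : IsIsentropicFlow P 𝒜) (hU : 𝒜 U x) : antisymmPart (jacobian (force P U) x) = 0 := by
  rw [antisymmPart_jacobian_force hP (h𝒜.isFlowClass.isRegularAt hU)]
  rcases h𝒜 with ⟨rfl, p, hp⟩ | ⟨s, rfl⟩
  · have hconst : P (density U x) = fun _ => p (density U x) := funext fun s => hp _ s hU.2
    rw [hconst, deriv_const, zero_mul, zero_div, zero_smul]
  · have hgrad : grad (entropy U) x = 0 :=
      funext fun i => (partialDeriv_congr hU.2 i).trans (partialDeriv_const s x i)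
    funext i j
    simp [hgrad, wedge]

theorem velocity_eulerRHS (hU : DifferentiableAt ℝ (velocity U) x) :
    velocity (eulerRHS P U) x = -fderiv ℝ (velocity U) x (velocity U x) - force P U x := by
  funext i
  rw [Pi.sub_apply, Pi.neg_apply, fderiv_apply_eq_jacobian hU]
  simp only [mul_comm (jacobian _ _ _ _)]
  rfl

theorem density_eulerRHS (hU : IsRegularAt U x) :
    density (eulerRHS P U) x = -(fderiv ℝ (density U) x (velocity U x) +
      density U x * divergence (velocity U) x) :=
  congrArg Neg.neg <| divergence_smul
    ((contDiffAt_density hU.contDiffAt).differentiableAt (by simp))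
    ((contDiffAt_velocity hU.contDiffAt).differentiableAt (by simp))

theorem entropy_eulerRHS : entropy (eulerRHS P U) x = -fderiv ℝ (entropy U) x (velocity U x) :=
  congrArg Neg.neg (fderiv_apply_eq_sum (entropy U) x (velocity U x)).symm

theorem contDiffAt_eulerRHS (hP : IsEquationOfState P) (hU : IsRegularAt U x) :
    ContDiffAt ℝ ∞ (eulerRHS P U) x := by
  have hu := contDiffAt_pi.1 (contDiffAt_velocity hU.contDiffAt)
  have hd := contDiffAt_density hU.contDiffAt
  have he := contDiffAt_entropy hU.contDiffAt
  refine ContDiffAt.prodMk (contDiffAt_pi.2 fun i => ?_) (ContDiffAt.prodMk ?_ ?_)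
  · exact (ContDiffAt.sum fun j _ => (hu j).mul (contDiffAt_partialDeriv (hu i) j)).neg.sub
      (contDiffAt_pi.1 (contDiffAt_force hP hU) i)
  · exact (ContDiffAt.sum fun i _ => contDiffAt_partialDeriv (hd.mul (hu i)) i).neg
  · exact (ContDiffAt.sum fun j _ => (hu j).mul (contDiffAt_partialDeriv he j)).neg

theorem IsRegularAt.add_smul_eulerRHS (hP : IsEquationOfState P) (hU : IsRegularAt U x) :
    ∀ᶠ ε : ℝ in 𝓝 0, IsRegularAt (U + ε • eulerRHS P U) x := by
  have hcont : Continuous fun ε : ℝ => density (U + ε • eulerRHS P U) x := by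
    change Continuous fun ε : ℝ => density U x + ε * density (eulerRHS P U) x
    fun_prop
  have hpos : 0 < density (U + (0 : ℝ) • eulerRHS P U) x := by simpa using hU.2
  filter_upwards [hcont.continuousAt.eventually (lt_mem_nhds hpos)] with ε hε
  refine ⟨?_, hε⟩
  filter_upwards [hU.eventually] with y hy
  exact hy.contDiffAt.add (contDiffAt_const.smul (contDiffAt_eulerRHS hP hy))

theorem IsFlowClass.add_smul_eulerRHS (hP : IsEquationOfState P) (h𝒜 : IsFlowClass 𝒜)
    (hU : 𝒜 U x) : ∀ᶠ ε : ℝ in 𝓝 0, 𝒜 (U + ε • eulerRHS P U) x := by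
  rcases h𝒜 with rfl | ⟨s, rfl⟩
  · exact hU.add_smul_eulerRHS hP
  · filter_upwards [hU.1.add_smul_eulerRHS hP] with ε hε
    refine ⟨hε, ?_⟩
    filter_upwards [hU.2, eventually_eventually_nhds.2 hU.2] with y hy hnhds
    have hrhs : entropy (eulerRHS P U) y = 0 := by
      rw [entropy_eulerRHS, Filter.EventuallyEq.fderiv_eq hnhds]
      simp
    calc entropy (U + ε • eulerRHS P U) y = entropy U y + ε * entropy (eulerRHS P U) y := rfl
      _ = s := by rw [hrhs, mul_zero, add_zero, hy]

theorem jacobian_velocity_eulerRHS (hP : IsEquationOfState P) (hU : IsRegularAt U x)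
    (i j : Fin n) :
    jacobian (velocity (eulerRHS P U)) x i j =
      -(∑ k, (velocity U x k * partialDeriv k (partialDeriv j fun y => velocity U y i) x +
        jacobian (velocity U) x k j * jacobian (velocity U) x i k)) -
        jacobian (force P U) x i j := by
  have hu := contDiffAt_pi.1 (contDiffAt_velocity hU.contDiffAt)
  have hd (k) : DifferentiableAt ℝ (fun y => velocity U y k) x := (hu k).differentiableAt (by simp)
  have hdd (k) : DifferentiableAt ℝ (partialDeriv k fun y => velocity U y i) x :=
    (contDiffAt_partialDeriv (hu i) k).differentiableAt (by simp)
  have hadv (k) := (hd k).fun_mul (hdd k)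
  have hforce := (contDiffAt_pi.1 (contDiffAt_force hP hU) i).differentiableAt (n := ∞) (by simp)
  refine (partialDeriv_sub (DifferentiableAt.fun_sum fun k _ => hadv k).fun_neg hforce j).trans ?_
  rw [partialDeriv_neg, partialDeriv_sum fun k _ => hadv k]
  simp only [partialDeriv_mul (hd _) (hdd _), partialDeriv_comm (hu i) j]
  rfl

/-- The vorticity equation: up to the torque of the forces, `ω` is transported as a two-form. -/
theorem curl_eulerRHS (hP : IsEquationOfState P) (hU : IsRegularAt U x) :
    curl (eulerRHS P U) x + fderiv ℝ (curl U) x (velocity U x) =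
      -infinitesimalCongruence (jacobian (velocity U) x) (curl U x) -
        antisymmPart (jacobian (force P U) x) := by
  rw [curl_eq_antisymmPart U]
  set A := jacobian (velocity U) x with hA
  have hc := (contDiffAt_curl hU.contDiffAt).differentiableAt (n := ∞) (by simp)
  have hadv (i j) : fderiv ℝ (curl U) x (velocity U x) i j = ∑ k, velocity U x k *
      ((partialDeriv k (partialDeriv j fun y => velocity U y i) x -
        partialDeriv k (partialDeriv i fun y => velocity U y j) x) / 2) := by
    rw [show fderiv ℝ (curl U) x (velocity U x) i j =
        fderiv ℝ (fun y => curl U y i j) x (velocity U x) by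
      rw [fderiv_apply (differentiableAt_pi.1 hc i), fderiv_apply hc]; rfl, fderiv_apply_eq_sum]
    exact Finset.sum_congr rfl fun k _ =>
      congrArg (velocity U x k * ·) (partialDeriv_curl hU.contDiffAt k i j)
  have hterm (i j k) :
      velocity U x k * ((partialDeriv k (partialDeriv j fun y => velocity U y i) x -
        partialDeriv k (partialDeriv i fun y => velocity U y j) x) / 2) +
      (A k i * antisymmPart A k j + antisymmPart A i k * A k j) =
      ((velocity U x k * partialDeriv k (partialDeriv j fun y => velocity U y i) x +
          A k j * A i k) -
        (velocity U x k * partialDeriv k (partialDeriv i fun y => velocity U y j) x +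
          A k i * A j k)) / 2 := by
    simp only [antisymmPart]
    ring
  funext i j
  have hsum := Finset.sum_congr (rfl : Finset.univ = Finset.univ) fun k _ => hterm i j k
  rw [← Finset.sum_div, Finset.sum_sub_distrib, Finset.sum_add_distrib] at hsum
  rw [curl_eq_antisymmPart (eulerRHS P U)]
  simp only [Pi.add_apply, Pi.sub_apply, Pi.neg_apply, hadv, infinitesimalCongruence,
    antisymmPart, jacobian_velocity_eulerRHS hP hU, hA] at hsum ⊢
  linear_combination hsum

end Flow

/-! ### The balance of a density of vorticity form -/

section Balance

/-- The values `(ρ, S, u, Φ(ω))` of the fields at a point, on which a density of vorticity form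
depends; `Φ(ω)` stands for the vorticity scalar or the vorticity vector. -/
def state {Z : Type*} (Φ : (Fin n → Fin n → ℝ) → Z) (U : Fields n) (x : Space n) :
    ℝ × ℝ × Space n × Z :=
  (density U x, entropy U x, velocity U x, Φ (curl U x))

theorem state_congr {Z : Type*} (Φ : (Fin n → Fin n → ℝ) → Z) {U V : Fields n} {x : Space n}
    (h : U =ᶠ[𝓝 x] V) : state Φ U x = state Φ V x := by
  have hcurl : curl U x = curl V x := by
    have hvel (k) : (fun y => velocity U y k) =ᶠ[𝓝 x] fun y => velocity V y k :=
      h.fun_comp fun p => p.1 k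
    funext i j
    rw [curl, curl, partialDeriv_congr (hvel i), partialDeriv_congr (hvel j)]
  simp only [state, density, entropy, velocity, hcurl, h.self_of_nhds]

theorem state_add_smul {Z : Type*} {Φ : (Fin n → Fin n → ℝ) → Z} {U V : Fields n}
    {x : Space n} (hU : DifferentiableAt ℝ (velocity U) x)
    (hV : DifferentiableAt ℝ (velocity V) x) (ε : ℝ) :
    state Φ (U + ε • V) x = (density U x + ε * density V x, entropy U x + ε * entropy V x,
      velocity U x + ε • velocity V x, Φ (curl U x + ε • curl V x)) := by
  rw [← curl_add_smul hU hV]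
  rfl

variable {Z : Type*} [NormedAddCommGroup Z] [NormedSpace ℝ Z] {Φ : (Fin n → Fin n → ℝ) → Z}
  {F : ℝ × ℝ × Space n × Z → ℝ} {T : ℝ → Fields n → Space n → ℝ}
  {𝒜 : Fields n → Space n → Prop} {P : ℝ → ℝ → ℝ} {U V : Fields n} {x : Space n}

/-- The first variation of the state of `U` in the direction of the fields `V`. -/
def stateVariation (Φ : (Fin n → Fin n → ℝ) → Z) (U V : Fields n) (x : Space n) :
    ℝ × ℝ × Space n × Z :=
  (density V x, entropy V x, velocity V x, fderiv ℝ Φ (curl U x) (curl V x))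

/-- `T` is the smooth function `F` of the state `(ρ, S, u, Φ(ω))`, on the fields of class `𝒜`. -/
structure IsVorticityDensity (𝒜 : Fields n → Space n → Prop) (Φ : (Fin n → Fin n → ℝ) → Z)
    (F : ℝ × ℝ × Space n × Z → ℝ) (T : ℝ → Fields n → Space n → ℝ) : Prop where
  contDiffOn : ContDiffOn ℝ ∞ F {q | 0 < q.1}
  apply_eq : ∀ t U x, 𝒜 U x → T t U x = F (state Φ U x)

theorem IsVorticityDensity.mono {ℬ : Fields n → Space n → Prop}
    (hT : IsVorticityDensity 𝒜 Φ F T) (h : ∀ U x, ℬ U x → 𝒜 U x) :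
    IsVorticityDensity ℬ Φ F T :=
  ⟨hT.contDiffOn, fun t U x hU => hT.apply_eq t U x (h U x hU)⟩

theorem hasFDerivAt_of_contDiffOn_pos_fst {E : Type*} [NormedAddCommGroup E] [NormedSpace ℝ E]
    {F : ℝ × E → ℝ} (hF : ContDiffOn ℝ ∞ F {q | 0 < q.1}) {q : ℝ × E} (hq : 0 < q.1) :
    HasFDerivAt F (fderiv ℝ F q) q :=
  ((hF.contDiffAt (isOpen_pos_fst.mem_nhds hq)).differentiableAt (by simp)).hasFDerivAt

theorem hasDerivAt_state (hΦ : ContDiff ℝ ∞ Φ) (hU : DifferentiableAt ℝ (velocity U) x)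
    (hV : DifferentiableAt ℝ (velocity V) x) :
    HasDerivAt (fun ε : ℝ => state Φ (U + ε • V) x) (stateVariation Φ U V x) 0 := by
  simp only [state_add_smul hU hV]
  have hline {E : Type _} [NormedAddCommGroup E] [NormedSpace ℝ E] (a b : E) :
      HasDerivAt (fun ε : ℝ => a + ε • b) b 0 := by
    simpa using ((hasDerivAt_id (0 : ℝ)).smul_const b).const_add a
  have hΦU := (hΦ.differentiable (by simp) (curl U x)).hasFDerivAt
  exact (hline _ _).prodMk ((hline _ _).prodMk ((hline _ _).prodMk
    (hΦU.comp_hasDerivAt_of_eq 0 (hline _ _) (by simp))))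

theorem hasFDerivAt_state (hΦ : ContDiff ℝ ∞ Φ) (hU : ContDiffAt ℝ ∞ U x) :
    HasFDerivAt (state Φ U) ((fderiv ℝ (density U) x).prod ((fderiv ℝ (entropy U) x).prod
      ((fderiv ℝ (velocity U) x).prod (fderiv ℝ Φ (curl U x) ∘L fderiv ℝ (curl U) x)))) x :=
  ((contDiffAt_density hU).differentiableAt (by simp)).hasFDerivAt.prodMk
    (((contDiffAt_entropy hU).differentiableAt (by simp)).hasFDerivAt.prodMk
      (((contDiffAt_velocity hU).differentiableAt (by simp)).hasFDerivAt.prodMk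
        ((hΦ.differentiable (by simp) (curl U x)).hasFDerivAt.comp x
          ((contDiffAt_curl hU).differentiableAt (by simp)).hasFDerivAt)))

theorem IsVorticityDensity.evolDeriv_eq (hT : IsVorticityDensity 𝒜 Φ F T) (hΦ : ContDiff ℝ ∞ Φ)
    (hP : IsEquationOfState P) (h𝒜 : IsFlowClass 𝒜) (t : ℝ) (hU : 𝒜 U x) :
    evolDeriv P T t U x = fderiv ℝ F (state Φ U x) (stateVariation Φ U (eulerRHS P U) x) := by
  have hreg := h𝒜.isRegularAt hU
  have hstate := hasDerivAt_state hΦ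
    ((contDiffAt_velocity hreg.contDiffAt).differentiableAt (by simp))
    ((contDiffAt_velocity (contDiffAt_eulerRHS hP hreg)).differentiableAt (by simp))
  have hF := hasFDerivAt_of_contDiffOn_pos_fst hT.contDiffOn (q := state Φ U x) hreg.2
  refine (Filter.EventuallyEq.deriv_eq ?_).trans
    (hF.comp_hasDerivAt_of_eq 0 hstate (by simp)).deriv
  filter_upwards [h𝒜.add_smul_eulerRHS hP hU] with ε hε using hT.apply_eq _ _ _ hε

theorem IsVorticityDensity.divergence_smul_velocity (hT : IsVorticityDensity 𝒜 Φ F T)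
    (hΦ : ContDiff ℝ ∞ Φ) (h𝒜 : IsFlowClass 𝒜) (t : ℝ) (hU : 𝒜 U x) :
    divergence (fun y => T t U y • velocity U y) x =
      fderiv ℝ F (state Φ U x) (fderiv ℝ (density U) x (velocity U x),
        fderiv ℝ (entropy U) x (velocity U x), fderiv ℝ (velocity U) x (velocity U x),
        fderiv ℝ Φ (curl U x) (fderiv ℝ (curl U) x (velocity U x))) +
      F (state Φ U x) * divergence (velocity U) x := by
  have hreg := h𝒜.isRegularAt hU
  have hF := hasFDerivAt_of_contDiffOn_pos_fst hT.contDiffOn (q := state Φ U x) hreg.2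
  have hcomp := hF.comp x (hasFDerivAt_state hΦ hreg.contDiffAt)
  have hTF : (fun y => T t U y • velocity U y) =ᶠ[𝓝 x]
      fun y => (F ∘ state Φ U) y • velocity U y := by
    filter_upwards [h𝒜.eventually hU] with y hy
    rw [hT.apply_eq t U y hy, Function.comp_apply]
  rw [divergence_congr hTF, divergence_smul hcomp.differentiableAt
    ((contDiffAt_velocity hreg.contDiffAt).differentiableAt (by simp)), hcomp.fderiv]
  rfl

/-- The transport terms `u·∇` cancel, so only stretching, compression and forces remain. -/
theorem IsVorticityDensity.movingFlux_eq (hT : IsVorticityDensity 𝒜 Φ F T) (hΦ : ContDiff ℝ ∞ Φ)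
    (hP : IsEquationOfState P) (h𝒜 : IsFlowClass 𝒜) (t : ℝ) (hU : 𝒜 U x) :
    evolDeriv P T t U x + divergence (fun y => T t U y • velocity U y) x =
      fderiv ℝ F (state Φ U x) (-(density U x * divergence (velocity U) x), 0, -force P U x,
        fderiv ℝ Φ (curl U x) (-infinitesimalCongruence (jacobian (velocity U) x) (curl U x) -
          antisymmPart (jacobian (force P U) x))) +
      F (state Φ U x) * divergence (velocity U) x := by
  have hreg := h𝒜.isRegularAt hU
  rw [hT.evolDeriv_eq hΦ hP h𝒜 t hU, hT.divergence_smul_velocity hΦ h𝒜 t hU, ← add_assoc,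
    ← map_add, stateVariation, density_eulerRHS hreg, entropy_eulerRHS, velocity_eulerRHS
    ((contDiffAt_velocity hreg.contDiffAt).differentiableAt (by simp)),
    ← curl_eulerRHS hP hreg, (fderiv ℝ Φ (curl U x)).map_add]
  congr 2
  simp only [Prod.mk_add_mk, Prod.mk.injEq, and_true]
  exact ⟨by ring, by ring, by abel⟩

/-- The stretching of the vorticity scalar compensates the compression of the fluid. -/
theorem movingFlux_const_mul_pfaffian {κ : Type*} [Fintype κ]
    {e : κ × Bool ≃ Fin n} {c : ℝ} (hT : ∀ t U x, 𝒜 U x → T t U x = c * pfaffian e (curl U x))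
    (hP : IsEquationOfState P) (h𝒜 : IsFlowClass 𝒜) (t : ℝ) (hU : 𝒜 U x) :
    evolDeriv P T t U x + divergence (fun y => T t U y • velocity U y) x =
      -(c * fderiv ℝ (pfaffian e) (curl U x) (antisymmPart (jacobian (force P U) x))) := by
  classical
  let L : ℝ × ℝ × Space n × ℝ →L[ℝ] ℝ := c • (ContinuousLinearMap.snd ℝ (Space n) ℝ ∘L
    ContinuousLinearMap.snd ℝ ℝ (Space n × ℝ) ∘L ContinuousLinearMap.snd ℝ ℝ _)
  have hTL : IsVorticityDensity 𝒜 (pfaffian e) L T := ⟨L.contDiff.contDiffOn, hT⟩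
  have hdiv : divergence (velocity U) x = ∑ i, jacobian (velocity U) x i i := rfl
  have hL (q : ℝ × ℝ × Space n × ℝ) : L q = c * q.2.2.2 := rfl
  rw [hTL.movingFlux_eq (contDiff_pfaffian e) hP h𝒜 t hU, L.fderiv, map_sub, map_neg,
    fderiv_pfaffian_infinitesimalCongruence, hdiv, hL, hL, state]
  ring

end Balance

/-! ### Affine fields -/

section AffineField

variable {p : Phase n} {A : Fin n → Fin n → ℝ} {a b x : Space n}

/-- The affine fields with value `p` at the origin, velocity gradient `A`, density gradient `a` and
entropy gradient `b`. -/
def affineField (p : Phase n) (A : Fin n → Fin n → ℝ) (a b : Space n) : Fields n := fun x =>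
  p + (fun i => ∑ j, A i j * x j, ∑ j, a j * x j, ∑ j, b j * x j)

theorem contDiff_affineField {k : WithTop ℕ∞} : ContDiff ℝ k (affineField p A a b) := by
  unfold affineField
  fun_prop

theorem affineField_zero : affineField p A a b 0 = p := by
  ext <;> simp [affineField]

theorem isRegularAt_affineField (hp : 0 < p.2.1) : IsRegularAt (affineField p A a b) 0 :=
  ⟨.of_forall fun _ => contDiff_affineField.contDiffAt, by rwa [density, affineField_zero]⟩

theorem isConstEntropyAt_affineField (hp : 0 < p.2.1) :
    IsConstEntropyAt p.2.2 (affineField p A 0 0) x :=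
  ⟨⟨.of_forall fun _ => contDiff_affineField.contDiffAt, by simpa [density, affineField]⟩,
    .of_forall fun _ => by simp [entropy, affineField]⟩

theorem partialDeriv_add_sum_mul (c : ℝ) (a x : Space n) (i : Fin n) :
    partialDeriv i (fun y => c + ∑ j, a j * y j) x = a i := by
  rw [partialDeriv_add (by fun_prop) (by fun_prop), partialDeriv_const,
    partialDeriv_sum fun k _ => by fun_prop]
  simp_rw [partialDeriv_const_mul (differentiableAt_apply _ x), partialDeriv_coord]
  simp [Pi.single_apply]

theorem grad_density_affineField : grad (density (affineField p A a b)) x = a :=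
  funext (partialDeriv_add_sum_mul p.2.1 a x)

theorem grad_entropy_affineField : grad (entropy (affineField p A a b)) x = b :=
  funext (partialDeriv_add_sum_mul p.2.2 b x)

theorem jacobian_velocity_affineField : jacobian (velocity (affineField p A a b)) x = A :=
  funext₂ fun i j => partialDeriv_add_sum_mul (p.1 i) (A i) x j

theorem curl_affineField : curl (affineField p A a b) x = antisymmPart A := by
  rw [curl_eq_antisymmPart, jacobian_velocity_affineField]

end AffineField

/-! ### Constraints from affine fields -/

section Constraints

variable {Z : Type*} [NormedAddCommGroup Z] [NormedSpace ℝ Z] {Φ : (Fin n → Fin n → ℝ) → Z}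
  {F : ℝ × ℝ × Space n × Z → ℝ} {T : ℝ → Fields n → Space n → ℝ} {P : ℝ → ℝ → ℝ}
  {M : Fin n → Fin n → ℝ}

theorem infinitesimalCongruence_one_add (hM : ∀ i j, M j i = -M i j) :
    infinitesimalCongruence (fun i j => (1 : Matrix (Fin n) (Fin n) ℝ) i j + M i j) M =
      (2 : ℝ) • M := by
  funext i j
  have hcancel (k) : M k i * M k j + M i k * M k j = 0 := by rw [hM i k]; ring
  calc ∑ k, (((1 : Matrix (Fin n) (Fin n) ℝ) k i + M k i) * M k j +
        M i k * ((1 : Matrix (Fin n) (Fin n) ℝ) k j + M k j))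
      = ∑ k, ((1 : Matrix (Fin n) (Fin n) ℝ) k i * M k j +
          M i k * (1 : Matrix (Fin n) (Fin n) ℝ) k j) :=
        Finset.sum_congr rfl fun k _ => by linear_combination hcancel k
    _ = 2 * M i j := by simp [Finset.sum_add_distrib, Matrix.one_apply, two_mul]

theorem fderiv_self_of_homogeneous {E Z : Type*} [NormedAddCommGroup E] [NormedSpace ℝ E]
    [NormedAddCommGroup Z] [NormedSpace ℝ Z] {Φ : E → Z} {m : ℕ} {v : E}
    (hΦ : ∀ (c : ℝ) v, Φ (c • v) = c ^ m • Φ v) (hd : DifferentiableAt ℝ Φ v) :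
    fderiv ℝ Φ v v = (m : ℝ) • Φ v := by
  have hline : HasDerivAt (fun c : ℝ => c • v) v 1 := by
    simpa using (hasDerivAt_id (1 : ℝ)).smul_const v
  have hpow := (hasDerivAt_pow m (1 : ℝ)).smul_const (Φ v)
  simp only [one_pow, mul_one] at hpow
  refine (hd.hasFDerivAt.comp_hasDerivAt_of_eq 1 hline (one_smul ℝ v).symm).unique ?_
  exact hpow.congr_of_eventuallyEq (.of_forall fun c => hΦ c v)

/-- The balance on the fields `x ↦ u + (1 + M)x`, which expand isotropically while rotating. -/
theorem IsVorticityDensity.expansion_balance {s : ℝ} {m : ℕ}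
    (hT : IsVorticityDensity (IsConstEntropyAt s) Φ F T) (hΦ : ContDiff ℝ ∞ Φ)
    (hhom : ∀ (c : ℝ) M, Φ (c • M) = c ^ m • Φ M) (hP : IsEquationOfState P)
    (hflux : HasZeroMovingFlux P (IsConstEntropyAt s) T) {ρ : ℝ} (hρ : 0 < ρ) (u : Space n)
    (hM : ∀ i j, M j i = -M i j) :
    n * (F (ρ, s, u, Φ M) - ρ * fderiv ℝ F (ρ, s, u, Φ M) (1, 0, 0, 0)) =
      2 * m * fderiv ℝ F (ρ, s, u, Φ M) (0, 0, 0, Φ M) := by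
  set A : Fin n → Fin n → ℝ := fun i j => (1 : Matrix (Fin n) (Fin n) ℝ) i j + M i j with hA
  set U := affineField (u, ρ, s) A 0 0 with hUdef
  have hU : IsConstEntropyAt s U 0 := isConstEntropyAt_affineField (p := (u, ρ, s)) hρ
  have hcurl : curl U 0 = M := by
    rw [curl_affineField]
    funext i j
    simp only [antisymmPart, hA, hM i j, Matrix.one_apply, eq_comm (a := j)]
    ring
  have hstate : state Φ U 0 = (ρ, s, u, Φ M) := by
    rw [state, hcurl, density, entropy, velocity, hUdef, affineField_zero]
  have hdiv : divergence (velocity U) 0 = n := by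
    change ∑ i, jacobian (velocity U) 0 i i = n
    have hdiag (i) : M i i = 0 := by linarith [hM i i]
    simp [hUdef, jacobian_velocity_affineField, hA, hdiag]
  have hforce : force P U 0 = 0 := by
    rw [force, grad_pressure hP hU.1, grad_density_affineField, grad_entropy_affineField]
    simp
  have htorque : antisymmPart (jacobian (force P U) 0) = 0 := by
    rw [antisymmPart_jacobian_force hP hU.1, grad_density_affineField]
    ext i j
    simp [wedge]
  have hbalance := (hT.movingFlux_eq hΦ hP (.inr ⟨s, rfl⟩) 0 hU).symm.trans (hflux 0 U 0 hU)
  rw [hdiv, hforce, htorque, hcurl, hstate, hUdef, jacobian_velocity_affineField,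
    infinitesimalCongruence_one_add hM, neg_zero, sub_zero, map_neg, map_smul,
    fderiv_self_of_homogeneous hhom (hΦ.differentiable (by simp) M)] at hbalance
  have hρ0 : density U 0 = ρ := congrArg Prod.fst hstate
  have hsplit : (-(density U 0 * n), 0, 0, -((2 : ℝ) • (m : ℝ) • Φ M)) =
      -(ρ * n) • ((1, 0, 0, 0) : ℝ × ℝ × Space n × Z) -
        (2 * m : ℝ) • ((0, 0, 0, Φ M) : ℝ × ℝ × Space n × Z) := by
    simp [hρ0, smul_smul]
  rw [hsplit, map_sub, map_smul, map_smul, smul_eq_mul, smul_eq_mul] at hbalance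
  linear_combination hbalance

/-- A multiple of the vorticity scalar is not conserved when a linear flow is stratified so that
the baroclinic torque acts in a coordinate plane of the vorticity. -/
theorem eq_zero_of_isNonisentropic {κ : Type*} [Fintype κ] [Nonempty κ]
    {e : κ × Bool ≃ Fin n} (hP : IsEquationOfState P) (hS : IsNonisentropic P) {c : ℝ}
    (hT : ∀ t U x, IsRegularAt U x → T t U x = c * pfaffian e (curl U x))
    (hflux : HasZeroMovingFlux P IsRegularAt T) : c = 0 := by
  classical
  obtain ⟨ρ, s, hρ, hPs⟩ := hS
  obtain ⟨k⟩ := ‹Nonempty κ›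
  set M := blockForm e (Function.update 1 k 0)
  set U := affineField (0, ρ, s) M (Pi.single (e (k, false)) 1) (Pi.single (e (k, true)) 1)
    with hUdef
  have hU : IsRegularAt U 0 := isRegularAt_affineField (p := (0, ρ, s)) hρ
  have hcurl : curl U 0 = M :=
    curl_affineField.trans (antisymmPart_eq_self (blockForm_antisymm e _))
  have hρ0 : density U 0 = ρ := by rw [density, hUdef, affineField_zero]
  have hs0 : entropy U 0 = s := by rw [entropy, hUdef, affineField_zero]
  have htorque : antisymmPart (jacobian (force P U) 0) =
      (deriv (P ρ) s * ρ⁻¹ ^ 2 / 2) • blockForm e (Pi.single k 1) := by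
    rw [antisymmPart_jacobian_force hP hU, hρ0, hs0, hUdef, grad_density_affineField,
      grad_entropy_affineField, blockForm_single]
  have hbalance := (movingFlux_const_mul_pfaffian hT hP (.inl rfl) 0 hU).symm.trans
    (hflux 0 U 0 hU)
  rw [htorque, hcurl, map_smul, fderiv_pfaffian_blockForm, smul_eq_mul, neg_eq_zero] at hbalance
  refine (mul_eq_zero.1 hbalance).resolve_right (mul_ne_zero ?_
    (pfaffian_blockForm_one_pos e).ne')
  positivity

end Constraints

/-! ### Test functions -/

section TestFunctions

open MeasureTheory

variable {E : Type*} [NormedAddCommGroup E] [NormedSpace ℝ E] [MeasurableSpace E] [BorelSpace E]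
  {μ : Measure E}

theorem eq_zero_of_forall_integral_mul_eq_zero [FiniteDimensional ℝ E]
    [IsLocallyFiniteMeasure μ] [μ.IsOpenPosMeasure] {g : E → ℝ} (hg : Continuous g)
    (h : ∀ φ : E → ℝ, ContDiff ℝ ∞ φ → HasCompactSupport φ → ∫ x, φ x * g x ∂μ = 0) : g = 0 :=
  (hg.ae_eq_iff_eq μ continuous_const).1
    (ae_eq_zero_of_integral_contDiff_smul_eq_zero hg.locallyIntegrable h)

theorem fderiv_apply_eq_zero_of_forall_integral_mul_fderiv_eq_zero [FiniteDimensional ℝ E]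
    [μ.IsAddHaarMeasure] {g : E → ℝ} (hg : ContDiff ℝ 1 g) {v : E}
    (h : ∀ φ : E → ℝ, ContDiff ℝ ∞ φ → HasCompactSupport φ → ∫ x, g x * fderiv ℝ φ x v ∂μ = 0)
    (x : E) : fderiv ℝ g x v = 0 := by
  have hg' : Continuous fun x => fderiv ℝ g x v :=
    (hg.continuous_fderiv one_ne_zero).clm_apply continuous_const
  refine congrFun (eq_zero_of_forall_integral_mul_eq_zero (μ := μ) hg' fun φ hφ hφc => ?_) x
  have hφ' : Continuous fun x => fderiv ℝ φ x v :=
    (hφ.continuous_fderiv (by simp)).clm_apply continuous_const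
  have hparts := integral_mul_fderiv_eq_neg_fderiv_mul_of_integrable (μ := μ) (f := g) (g := φ)
    (v := v) ((hg'.mul hφ.continuous).integrable_of_hasCompactSupport hφc.mul_left)
    ((hg.continuous.mul hφ').integrable_of_hasCompactSupport (hφc.fderiv_apply ℝ v).mul_left)
    ((hg.continuous.mul hφ.continuous).integrable_of_hasCompactSupport hφc.mul_left)
    (fun x _ => hg.differentiable one_ne_zero x) (fun x _ => hφ.differentiable (by simp) x)
  rw [h φ hφ hφc, eq_comm, neg_eq_zero] at hparts
  simpa only [mul_comm] using hparts

theorem integral_deriv_eq_zero [SecondCountableTopology E] [IsFiniteMeasureOnCompacts μ]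
    {h : ℝ → E → ℝ} {s : Set ℝ} (hs : IsOpen s) (h0 : 0 ∈ s)
    (hh : ContDiffOn ℝ 1 (fun q : ℝ × E => h q.1 q.2) (s ×ˢ Set.univ))
    {K : Set E} (hK : IsCompact K) (hc : ∀ ε, ∀ x ∉ K, h ε x = h 0 x)
    (hI : ∀ ε ∈ s, ∫ x, (h ε x - h 0 x) ∂μ = 0) : ∫ x, deriv (fun ε => h ε x) 0 ∂μ = 0 := by
  have hopen : IsOpen (s ×ˢ (Set.univ : Set E)) := hs.prod isOpen_univ
  set h' : ℝ → E → ℝ := fun ε x => fderiv ℝ (fun q : ℝ × E => h q.1 q.2) (ε, x) (1, 0)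
  have hd : ∀ ε ∈ s, ∀ x, HasDerivAt (fun ε => h ε x) (h' ε x) ε := fun ε hε x =>
    ((hh.contDiffAt (hopen.mem_nhds ⟨hε, trivial⟩)).differentiableAt
      one_ne_zero).hasFDerivAt.comp_hasDerivAt ε ((hasDerivAt_id ε).prodMk (hasDerivAt_const ε x))
  have hcont' : ContinuousOn (fun q : ℝ × E => h' q.1 q.2) (s ×ˢ Set.univ) :=
    (hh.continuousOn_fderiv_of_isOpen hopen le_rfl).clm_apply continuousOn_const
  have hslice {g : ℝ → E → ℝ} (hg : ContinuousOn (fun q : ℝ × E => g q.1 q.2) (s ×ˢ Set.univ))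
      {ε : ℝ} (hε : ε ∈ s) : Continuous (g ε) :=
    hg.comp_continuous (f := fun x => (ε, x)) (by fun_prop) fun x => ⟨hε, trivial⟩
  obtain ⟨I, hIc, hI0, hIs⟩ := exists_compact_subset hs h0
  obtain ⟨C, hC⟩ := (hIc.prod hK).exists_bound_of_continuousOn
    (hcont'.mono (Set.prod_mono hIs (Set.subset_univ _)))
  have hbound : ∀ x, ∀ ε ∈ I, ‖h' ε x‖ ≤ K.indicator (fun _ => C) x := by
    intro x ε hε
    by_cases hx : x ∈ K
    · simpa [hx] using hC (ε, x) ⟨hε, hx⟩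
    · have hconst : HasDerivAt (fun ε => h ε x) 0 ε := by
        simpa only [hc _ x hx] using hasDerivAt_const ε (h 0 x)
      simp [(hd ε (hIs hε) x).unique hconst, hx]
  have hderiv := (hasDerivAt_integral_of_dominated_loc_of_deriv_le (μ := μ)
    (F := fun ε x => h ε x - h 0 x) (F' := h') (bound := K.indicator fun _ => C)
    (mem_interior_iff_mem_nhds.1 hI0)
    (Filter.mem_of_superset (hs.mem_nhds h0) fun ε hε =>
      ((hslice hh.continuousOn hε).sub (hslice hh.continuousOn h0)).aestronglyMeasurable)
    (by simp) (hslice hcont' h0).aestronglyMeasurable (.of_forall hbound)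
    ((integrableOn_const hK.measure_lt_top.ne).integrable_indicator hK.measurableSet)
    (.of_forall fun x ε hε => (hd ε (hIs hε) x).sub_const _)).2
  have hzero : HasDerivAt (fun ε => ∫ x, (h ε x - h 0 x) ∂μ) 0 0 :=
    (hasDerivAt_const (0 : ℝ) (0 : ℝ)).congr_of_eventuallyEq
      (Filter.mem_of_superset (hs.mem_nhds h0) hI)
  simpa only [(hd 0 h0 _).deriv] using hderiv.unique hzero

end TestFunctions

/-! ### The first variation of a total divergence -/

section FirstVariation

open MeasureTheory

variable {𝒜 : Fields n → Space n → Prop} {Θ : ℝ → Fields n → Space n → Space n} {U V : Fields n}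
  {x : Space n}

theorem integral_partialDeriv_eq_zero {f : Space n → ℝ} (hf : ContDiff ℝ 1 f)
    (hc : HasCompactSupport f) (i : Fin n) : ∫ x, partialDeriv i f x = 0 := by
  have hparts := integral_mul_fderiv_eq_neg_fderiv_mul_of_integrable (μ := volume)
    (f := fun _ : Space n => (1 : ℝ)) (g := f) (v := Pi.single i 1) (by simp)
    (by simpa using! ((hf.continuous_fderiv one_ne_zero).clm_apply
      continuous_const).integrable_of_hasCompactSupport (hc.fderiv_apply ℝ (Pi.single i 1)))
    (by simpa using hf.continuous.integrable_of_hasCompactSupport hc)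
    (fun x _ => differentiableAt_const _) (fun x _ => hf.differentiable one_ne_zero x)
  simpa using! hparts

theorem integral_divergence_eq_zero {Y : Space n → Space n} (hY : ContDiff ℝ 1 Y)
    (hc : HasCompactSupport Y) : ∫ x, divergence Y x = 0 := by
  have hYi (i) : ContDiff ℝ 1 fun x => Y x i := contDiff_pi.1 hY i
  have hci (i : Fin n) : HasCompactSupport fun x => Y x i :=
    hc.comp_left (g := fun v : Space n => v i) rfl
  have hint (i : Fin n) : Integrable (partialDeriv i fun x => Y x i) :=
    (((hYi i).continuous_fderiv one_ne_zero).clm_apply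
      continuous_const).integrable_of_hasCompactSupport ((hci i).fderiv_apply ℝ _)
  unfold divergence
  rw [integral_finsetSum _ fun i _ => hint i]
  exact Finset.sum_eq_zero fun i _ => integral_partialDeriv_eq_zero (hYi i) (hci i) i

theorem IsLocalVector.contDiffAt (hΘ : IsLocalVector 𝒜 Θ) (h𝒜 : IsFlowClass 𝒜) (hU : 𝒜 U x)
    (t : ℝ) : ContDiffAt ℝ ∞ (Θ t U) x := by
  obtain ⟨k, L, hL, hΘL⟩ := hΘ
  have hreg := h𝒜.isRegularAt hU
  have hopen : IsOpen {q : ℝ × Space n × Phase n × Derivs n k | 0 < q.2.2.1.2.1} :=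
    isOpen_lt continuous_const (by fun_prop)
  have hjet : ContDiffAt ℝ ∞ (fun y j => iteratedFDeriv ℝ (j.1 + 1) U y : _ → Derivs n k) x :=
    contDiffAt_pi.2 fun j => hreg.contDiffAt.iteratedFDeriv_right (i := j.1 + 1) (m := ∞)
      (by exact_mod_cast le_rfl)
  have hLx : ContDiffAt ℝ ∞ L (t, x, U x, fun j => iteratedFDeriv ℝ (j.1 + 1) U x) :=
    hL.contDiffAt (hopen.mem_nhds hreg.2)
  refine (hLx.comp x (contDiffAt_const.prodMk (contDiffAt_id.prodMk
    (hreg.contDiffAt.prodMk hjet)))).congr_of_eventuallyEq ?_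
  filter_upwards [h𝒜.eventually hU] with y hy using hΘL t U y hy

theorem IsLocalVector.eq_of_eventuallyEq (hΘ : IsLocalVector 𝒜 Θ) (hU : 𝒜 U x) (hV : 𝒜 V x)
    (h : U =ᶠ[𝓝 x] V) (t : ℝ) : Θ t U x = Θ t V x := by
  obtain ⟨k, L, -, hΘL⟩ := hΘ
  rw [hΘL t U x hU, hΘL t V x hV, h.self_of_nhds,
    funext fun j : Fin k => (h.iteratedFDeriv ℝ (j.1 + 1)).self_of_nhds]

theorem integral_totalDiv_sub_eq_zero (h𝒜 : IsFlowClass 𝒜) (hΘ : IsLocalVector 𝒜 Θ)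
    (hU : ∀ x, 𝒜 U x) (hV : ∀ x, 𝒜 V x) (hUV : HasCompactSupport (U - V)) (t : ℝ) :
    ∫ x, (totalDiv Θ t U x - totalDiv Θ t V x) = 0 := by
  have hsmooth {W : Fields n} (hW : ∀ x, 𝒜 W x) : ContDiff ℝ ∞ (Θ t W) :=
    contDiff_iff_contDiffAt.2 fun x => hΘ.contDiffAt h𝒜 (hW x) t
  have hsupp : HasCompactSupport fun x => Θ t U x - Θ t V x := by
    refine .intro hUV fun x hx => sub_eq_zero.2 (hΘ.eq_of_eventuallyEq (hU x) (hV x) ?_ t)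
    filter_upwards [notMem_tsupport_iff_eventuallyEq.1 hx] with y hy using sub_eq_zero.1 hy
  rw [← integral_divergence_eq_zero
    (((hsmooth hU).sub (hsmooth hV)).of_le (by exact_mod_cast le_top)) hsupp]
  exact integral_congr_ae (.of_forall fun x => (divergence_sub
    ((hsmooth hU).differentiable (by simp) x) ((hsmooth hV).differentiable (by simp) x)).symm)

variable {Z : Type*} [NormedAddCommGroup Z] [NormedSpace ℝ Z] {Φ : (Fin n → Fin n → ℝ) → Z}
  {F : ℝ × ℝ × Space n × Z → ℝ}

theorem contDiff_state_add_smul (hΦ : ContDiff ℝ ∞ Φ) (hU : ContDiff ℝ ∞ U)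
    (hV : ContDiff ℝ ∞ V) :
    ContDiff ℝ ∞ fun q : ℝ × Space n => state Φ (U + q.1 • V) q.2 := by
  have hvel {W : Fields n} (hW : ContDiff ℝ ∞ W) : ContDiff ℝ ∞ (velocity W) := hW.fst
  have hcurl {W : Fields n} (hW : ContDiff ℝ ∞ W) : ContDiff ℝ ∞ (curl W) :=
    contDiff_iff_contDiffAt.2 fun x => contDiffAt_curl hW.contDiffAt
  have hline {E : Type _} [NormedAddCommGroup E] [NormedSpace ℝ E] {f g : Space n → E}
      (hf : ContDiff ℝ ∞ f) (hg : ContDiff ℝ ∞ g) :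
      ContDiff ℝ ∞ fun q : ℝ × Space n => f q.2 + q.1 • g q.2 :=
    (hf.comp contDiff_snd).add (contDiff_fst.smul (hg.comp contDiff_snd))
  simp only [state_add_smul ((hvel hU).differentiable (by simp) _)
    ((hvel hV).differentiable (by simp) _)]
  exact (hline hU.snd.fst hV.snd.fst).prodMk ((hline hU.snd.snd hV.snd.snd).prodMk
    ((hline (hvel hU) (hvel hV)).prodMk (hΦ.comp (hline (hcurl hU) (hcurl hV)))))

/-- A total divergence is a null Lagrangian. -/
theorem IsVorticityDensity.integral_fderiv_stateVariation_eq_zero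
    (hT : IsVorticityDensity 𝒜 Φ F (totalDiv Θ)) (hΦ : ContDiff ℝ ∞ Φ) (h𝒜 : IsFlowClass 𝒜)
    (hΘ : IsLocalVector 𝒜 Θ) (hU : ContDiff ℝ ∞ U) (hV : ContDiff ℝ ∞ V)
    (hVc : HasCompactSupport V) (hUV : ∀ᶠ ε in 𝓝 (0 : ℝ), ∀ x, 𝒜 (U + ε • V) x) :
    ∫ x, fderiv ℝ F (state Φ U x) (stateVariation Φ U V x) = 0 := by
  obtain ⟨s, hs, hsopen, hs0⟩ := mem_nhds_iff.1 hUV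
  have hstate0 (x) : state Φ (U + (0 : ℝ) • V) x = state Φ U x := by simp
  have hdiff {W : Fields n} (hW : ContDiff ℝ ∞ W) (x) : DifferentiableAt ℝ (velocity W) x :=
    (contDiffAt_velocity hW.contDiffAt).differentiableAt (by simp)
  have hderiv (x) : deriv (fun ε : ℝ => F (state Φ (U + ε • V) x)) 0 =
      fderiv ℝ F (state Φ U x) (stateVariation Φ U V x) := by
    have hpos : 0 < (state Φ U x).1 := hstate0 x ▸ (h𝒜.isRegularAt (hs hs0 x)).2
    exact ((hasFDerivAt_of_contDiffOn_pos_fst hT.contDiffOn hpos).comp_hasDerivAt_of_eq 0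
      (hasDerivAt_state hΦ (hdiff hU x) (hdiff hV x)) (hstate0 x).symm).deriv
  simp only [← hderiv]
  refine integral_deriv_eq_zero hsopen hs0 ((hT.contDiffOn.comp
    (contDiff_state_add_smul hΦ hU hV).contDiffOn fun q hq =>
      (h𝒜.isRegularAt (hs hq.1 q.2)).2).of_le (by exact_mod_cast le_top)) hVc ?_ ?_
  · intro ε x hx
    refine congrArg F (state_congr Φ ?_)
    filter_upwards [notMem_tsupport_iff_eventuallyEq.1 hx] with y hy
    simp [hy]
  · intro ε hε
    simp only [← hT.apply_eq 0 _ _ (hs hε _), ← hT.apply_eq 0 _ _ (hs hs0 _)]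
    refine integral_totalDiv_sub_eq_zero h𝒜 hΘ (hs hε) (hs hs0) ?_ 0
    have hεV : HasCompactSupport (ε • V) := hVc.smul_left (f := fun _ => ε)
    simpa using hεV

theorem eventually_isRegularAt_add_smul (hU : ContDiff ℝ ∞ U) (hpos : ∀ x, 0 < density U x)
    (hV : ContDiff ℝ ∞ V) (hVc : HasCompactSupport V) :
    ∀ᶠ ε in 𝓝 (0 : ℝ), ∀ x, IsRegularAt (U + ε • V) x := by
  have hdensity : Continuous fun q : ℝ × Space n => density U q.2 + q.1 * density V q.2 :=
    (hU.snd.fst.continuous.comp continuous_snd).add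
      (continuous_fst.mul (hV.snd.fst.continuous.comp continuous_snd))
  have hsupp : ∀ᶠ ε in 𝓝 (0 : ℝ), ∀ x ∈ tsupport V, 0 < density U x + ε * density V x :=
    IsCompact.eventually_forall_of_forall_eventually hVc fun x _ =>
      hdensity.continuousAt.eventually (lt_mem_nhds (by simpa using hpos x))
  filter_upwards [hsupp] with ε hε x
  refine ⟨.of_forall fun y => (hU.add (hV.const_smul ε)).contDiffAt, ?_⟩
  by_cases hx : x ∈ tsupport V
  · exact hε x hx
  · simpa [density, image_eq_zero_of_notMem_tsupport hx] using hpos x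

theorem eventually_isConstEntropyAt_add_smul {s : ℝ} (hU : ContDiff ℝ ∞ U)
    (hpos : ∀ x, 0 < density U x) (hUs : ∀ x, entropy U x = s) (hV : ContDiff ℝ ∞ V)
    (hVc : HasCompactSupport V) (hVs : ∀ x, entropy V x = 0) :
    ∀ᶠ ε in 𝓝 (0 : ℝ), ∀ x, IsConstEntropyAt s (U + ε • V) x := by
  filter_upwards [eventually_isRegularAt_add_smul hU hpos hV hVc] with ε hε x
  refine ⟨hε x, .of_forall fun y => ?_⟩
  change entropy U y + ε * entropy V y = s
  rw [hUs, hVs, mul_zero, add_zero]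

end FirstVariation

/-! ### Classification of the densities -/

section Homogeneity

variable {k : ℝ → ℝ}

theorem deriv_eq_zero_of_mul_deriv_eq_zero (hk : Continuous (deriv k))
    (h : ∀ r, r * deriv k r = 0) : deriv k = 0 :=
  hk.ext_on (dense_compl_singleton (0 : ℝ)) continuous_const
    fun r hr => (mul_eq_zero.1 (h r)).resolve_left hr

theorem mul_deriv_deriv_eq (hk : Differentiable ℝ k) (hk' : Differentiable ℝ (deriv k)) {c : ℝ}
    (h : ∀ r, r * deriv k r = c * k r) (r : ℝ) :
    r * deriv (deriv k) r = (c - 1) * deriv k r := by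
  have hleft := (hasDerivAt_id' r).mul (hk' r).hasDerivAt
  have hright := (hk r).hasDerivAt.const_mul c
  linear_combination hleft.unique (hright.congr_of_eventuallyEq (.of_forall h))

theorem eq_mul_pow_of_mul_deriv_eq {N : ℕ} (hk : ContDiff ℝ ∞ k)
    (h : ∀ r, r * deriv k r = N * k r) (r : ℝ) : k r = k 1 * r ^ N := by
  have hkd : Differentiable ℝ k := hk.differentiable (by simp)
  have hk' : ContDiff ℝ ∞ (deriv k) := hk.iterate_deriv 1
  induction N generalizing k r with
  | zero =>
    have hzero := deriv_eq_zero_of_mul_deriv_eq_zero hk'.continuous fun r => by simpa using h r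
    simpa using is_const_of_deriv_eq_zero hkd (congrFun hzero) r 1
  | succ N ih =>
    have hk'd : Differentiable ℝ (deriv k) := hk'.differentiable (by simp)
    have hpow := ih hk' (fun r => by simpa using mul_deriv_deriv_eq hkd hk'd h r) r hk'd
      (hk'.iterate_deriv 1)
    have hN : ((N + 1 : ℕ) : ℝ) ≠ 0 := by positivity
    refine mul_left_cancel₀ hN ?_
    linear_combination r * hpow - h r + r ^ (N + 1) * h 1

end Homogeneity

section Classification

open scoped Matrix

variable {Z : Type*} [NormedAddCommGroup Z] [NormedSpace ℝ Z] {Φ : (Fin n → Fin n → ℝ) → Z}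
  {F : ℝ × ℝ × Space n × Z → ℝ} {Θ : ℝ → Fields n → Space n → Space n} {P : ℝ → ℝ → ℝ}
  {s ρ : ℝ} {M : Fin n → Fin n → ℝ}

theorem curl_smul_const {φ : Space n → ℝ} {x : Space n} (hφ : DifferentiableAt ℝ φ x)
    (p : Phase n) : curl (fun y => φ y • p) x = (2⁻¹ : ℝ) • wedge p.1 (grad φ x) := by
  have h := antisymmPart_jacobian_smul (Y := fun _ => p.1) hφ (differentiableAt_const _)
  rw [jacobian_const] at h
  rw [curl_eq_antisymmPart]
  refine h.trans ?_
  ext i j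
  simp [antisymmPart]

theorem density_affineField_zero_zero (p : Phase n) (A : Fin n → Fin n → ℝ) (x : Space n) :
    density (affineField p A 0 0) x = p.2.1 := by
  simp [density, affineField]

theorem entropy_affineField_zero_zero (p : Phase n) (A : Fin n → Fin n → ℝ) (x : Space n) :
    entropy (affineField p A 0 0) x = p.2.2 := by
  simp [entropy, affineField]

theorem eventually_isRegularAt_affineField_add {p : Phase n} (hp : 0 < p.2.1)
    (A : Fin n → Fin n → ℝ) (v : Phase n) {φ : Space n → ℝ} (hφ : ContDiff ℝ ∞ φ)
    (hφc : HasCompactSupport φ) :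
    ∀ᶠ ε in 𝓝 (0 : ℝ), ∀ x, IsRegularAt (affineField p A 0 0 + ε • fun x => φ x • v) x :=
  eventually_isRegularAt_add_smul contDiff_affineField
    (fun x => (density_affineField_zero_zero p A x).symm ▸ hp) (hφ.smul contDiff_const)
    hφc.smul_right

theorem eventually_isConstEntropyAt_affineField_add {p : Phase n} (hp : 0 < p.2.1)
    (A : Fin n → Fin n → ℝ) {v : Phase n} (hv : v.2.2 = 0) {φ : Space n → ℝ}
    (hφ : ContDiff ℝ ∞ φ) (hφc : HasCompactSupport φ) :
    ∀ᶠ ε in 𝓝 (0 : ℝ), ∀ x,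
      IsConstEntropyAt p.2.2 (affineField p A 0 0 + ε • fun x => φ x • v) x :=
  eventually_isConstEntropyAt_add_smul contDiff_affineField
    (fun x => (density_affineField_zero_zero p A x).symm ▸ hp) (entropy_affineField_zero_zero p A)
    (hφ.smul contDiff_const) hφc.smul_right fun x => by simp [entropy, hv]

theorem IsVorticityDensity.integral_affineField_eq_zero {𝒜 : Fields n → Space n → Prop}
    (hT : IsVorticityDensity 𝒜 Φ F (totalDiv Θ)) (hΦ : ContDiff ℝ ∞ Φ) (h𝒜 : IsFlowClass 𝒜)
    (hΘ : IsLocalVector 𝒜 Θ) {u : Space n} {A : Fin n → Fin n → ℝ} {v : Phase n}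
    {φ : Space n → ℝ} (hφ : ContDiff ℝ ∞ φ) (hφc : HasCompactSupport φ)
    (hv : ∀ᶠ ε in 𝓝 (0 : ℝ), ∀ x, 𝒜 (affineField (u, ρ, s) A 0 0 + ε • fun x => φ x • v) x) :
    ∫ x, fderiv ℝ F (ρ, s, velocity (affineField (u, ρ, s) A 0 0) x, Φ (antisymmPart A))
      (φ x * v.2.1, φ x * v.2.2, φ x • v.1,
        fderiv ℝ Φ (antisymmPart A) ((2⁻¹ : ℝ) • wedge v.1 (grad φ x))) = 0 := by
  refine (MeasureTheory.integral_congr_ae (.of_forall fun x => ?_)).trans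
    (hT.integral_fderiv_stateVariation_eq_zero hΦ h𝒜 hΘ contDiff_affineField
      (V := fun x => φ x • v) (hφ.smul contDiff_const) hφc.smul_right hv)
  simp only [state, stateVariation, density_affineField_zero_zero, entropy_affineField_zero_zero,
    curl_affineField, curl_smul_const (hφ.differentiable (by simp) x)]
  rfl

/-- Constant perturbations of the density and the entropy are not felt by the velocity field, so
that the first variation is undifferentiated. -/
theorem IsVorticityDensity.fderiv_thermodynamic_eq_zero {𝒜 : Fields n → Space n → Prop}
    (hT : IsVorticityDensity 𝒜 Φ F (totalDiv Θ)) (hΦ : ContDiff ℝ ∞ Φ) (h𝒜 : IsFlowClass 𝒜)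
    (hΘ : IsLocalVector 𝒜 Θ) (hρ : 0 < ρ) {u : Space n} (hM : ∀ i j, M j i = -M i j) {a b : ℝ}
    (hab : ∀ φ : Space n → ℝ, ContDiff ℝ ∞ φ → HasCompactSupport φ → ∀ᶠ ε in 𝓝 (0 : ℝ), ∀ x,
      𝒜 (affineField (u, ρ, s) M 0 0 + ε • fun x => φ x • ((0, a, b) : Phase n)) x) :
    fderiv ℝ F (ρ, s, u, Φ M) (a, b, 0, 0) = 0 := by
  set U := affineField (u, ρ, s) M 0 0 with hU
  have hcont : Continuous fun x => fderiv ℝ F (ρ, s, velocity U x, Φ M) (a, b, 0, 0) := by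
    have hvel : Continuous (velocity U) := (contDiff_affineField (k := 0)).continuous.fst
    exact ((hT.contDiffOn.continuousOn_fderiv_of_isOpen isOpen_pos_fst (by simp)).comp_continuous
      (f := fun x => (ρ, s, velocity U x, Φ M)) (by fun_prop) fun _ => hρ).clm_apply
        continuous_const
  have hzero := eq_zero_of_forall_integral_mul_eq_zero (μ := MeasureTheory.volume) hcont
    fun φ hφ hφc => by
      have h := hT.integral_affineField_eq_zero hΦ h𝒜 hΘ hφ hφc (hab φ hφ hφc)
      rw [antisymmPart_eq_self hM] at h
      have hφx (x) : ((φ x * a, φ x * b, φ x • 0,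
          fderiv ℝ Φ M ((2⁻¹ : ℝ) • wedge 0 (grad φ x))) : ℝ × ℝ × Space n × Z) =
          φ x • (a, b, 0, 0) := by
        have hw : wedge 0 (grad φ x) = 0 := by ext; simp [wedge]
        simp [hw]
      simpa only [hφx, (fderiv ℝ F _).map_smul, smul_eq_mul] using h
  have hvel : velocity U 0 = u := by rw [velocity, hU, affineField_zero]
  simpa only [hvel] using! congrFun hzero 0

theorem IsVorticityDensity.fderiv_density_eq_zero
    (hT : IsVorticityDensity (IsConstEntropyAt s) Φ F (totalDiv Θ)) (hΦ : ContDiff ℝ ∞ Φ)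
    (hΘ : IsLocalVector (IsConstEntropyAt s) Θ) (hρ : 0 < ρ) (u : Space n)
    (hM : ∀ i j, M j i = -M i j) : fderiv ℝ F (ρ, s, u, Φ M) (1, 0, 0, 0) = 0 :=
  hT.fderiv_thermodynamic_eq_zero hΦ (.inr ⟨s, rfl⟩) hΘ hρ hM fun _ hφ hφc =>
    eventually_isConstEntropyAt_affineField_add (p := (u, ρ, s)) hρ M rfl hφ hφc

theorem IsVorticityDensity.fderiv_entropy_eq_zero
    (hT : IsVorticityDensity IsRegularAt Φ F (totalDiv Θ)) (hΦ : ContDiff ℝ ∞ Φ)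
    (hΘ : IsLocalVector IsRegularAt Θ) (hρ : 0 < ρ) (s : ℝ) (u : Space n)
    (hM : ∀ i j, M j i = -M i j) : fderiv ℝ F (ρ, s, u, Φ M) (0, 1, 0, 0) = 0 :=
  hT.fderiv_thermodynamic_eq_zero hΦ (.inl rfl) hΘ hρ hM fun _ hφ hφc =>
    eventually_isRegularAt_affineField_add (p := (u, ρ, s)) hρ M _ hφ hφc

theorem IsVorticityDensity.apply_eq_apply_one
    (hT : IsVorticityDensity (IsConstEntropyAt s) Φ F (totalDiv Θ)) (hΦ : ContDiff ℝ ∞ Φ)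
    (hΘ : IsLocalVector (IsConstEntropyAt s) Θ) (hρ : 0 < ρ) (u : Space n)
    (hM : ∀ i j, M j i = -M i j) : F (ρ, s, u, Φ M) = F (1, s, u, Φ M) := by
  have hd : ∀ r ∈ Set.Ioi (0 : ℝ), HasDerivAt (fun r => F (r, s, u, Φ M)) 0 r := fun r hr =>
    hT.fderiv_density_eq_zero hΦ hΘ hr u hM ▸
      (hasFDerivAt_of_contDiffOn_pos_fst hT.contDiffOn (q := (r, s, u, Φ M)) hr).comp_hasDerivAt r
        ((hasDerivAt_id r).prodMk (hasDerivAt_const r _))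
  exact isOpen_Ioi.is_const_of_deriv_eq_zero isPreconnected_Ioi
    (fun r hr => (hd r hr).differentiableAt.differentiableWithinAt) (fun r hr => (hd r hr).deriv)
    hρ (Set.mem_Ioi.2 one_pos)

theorem IsVorticityDensity.euler_homogeneity {m : ℕ}
    (hT : IsVorticityDensity (IsConstEntropyAt s) Φ F (totalDiv Θ)) (hΦ : ContDiff ℝ ∞ Φ)
    (hhom : ∀ (c : ℝ) M, Φ (c • M) = c ^ m • Φ M) (hP : IsEquationOfState P)
    (hΘ : IsLocalVector (IsConstEntropyAt s) Θ)
    (hflux : HasZeroMovingFlux P (IsConstEntropyAt s) (totalDiv Θ)) (hρ : 0 < ρ) (u : Space n)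
    (hM : ∀ i j, M j i = -M i j) :
    2 * m * fderiv ℝ F (ρ, s, u, Φ M) (0, 0, 0, Φ M) = n * F (ρ, s, u, Φ M) := by
  rw [← hT.expansion_balance hΦ hhom hP hflux hρ u hM, hT.fderiv_density_eq_zero hΦ hΘ hρ u hM,
    mul_zero, sub_zero]

theorem hasDerivAt_slice {Z : Type*} [NormedAddCommGroup Z] [NormedSpace ℝ Z]
    {F : ℝ × ℝ × Space n × Z → ℝ} (hF : ContDiffOn ℝ ∞ F {q | 0 < q.1}) (hρ : 0 < ρ)
    (u : Space n) {z : ℝ → Z} {z' : Z} {r : ℝ} (hz : HasDerivAt z z' r) :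
    HasDerivAt (fun r => F (ρ, s, u, z r)) (fderiv ℝ F (ρ, s, u, z r) (0, 0, 0, z')) r :=
  (hasFDerivAt_of_contDiffOn_pos_fst hF (q := (ρ, s, u, z r)) hρ).comp_hasDerivAt r
    ((hasDerivAt_const r ρ).prodMk
      ((hasDerivAt_const r s).prodMk ((hasDerivAt_const r u).prodMk hz)))

/-- Along `r ↦ r²M` the density is even in `r` and homogeneous of odd degree `n`. -/
theorem IsVorticityDensity.apply_eq_zero_of_odd {F : ℝ × ℝ × Space n × Space n → ℝ} (hn : Odd n)
    (hT : IsVorticityDensity (IsConstEntropyAt s) pfaffianVec F (totalDiv Θ))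
    (hP : IsEquationOfState P) (hΘ : IsLocalVector (IsConstEntropyAt s) Θ)
    (hflux : HasZeroMovingFlux P (IsConstEntropyAt s) (totalDiv Θ)) (hρ : 0 < ρ) (u : Space n)
    (hM : ∀ i j, M j i = -M i j) : F (ρ, s, u, pfaffianVec M) = 0 := by
  set m := (n - 1) / 2
  set z : ℝ → Space n := fun r => pfaffianVec ((r ^ 2) • M) with hz
  have hz_eq : z = fun r => r ^ (2 * m) • pfaffianVec M := by
    funext r
    simp only [hz, pfaffianVec_smul, pow_mul, m]
  have hzd (r : ℝ) : HasDerivAt z ((2 * m * r ^ (2 * m - 1)) • pfaffianVec M) r := by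
    simpa [hz_eq] using (hasDerivAt_pow (2 * m) r).smul_const (pfaffianVec M)
  have hk : ContDiff ℝ ∞ fun r => F (ρ, s, u, z r) :=
    hT.contDiffOn.comp_contDiff (f := fun r => (ρ, s, u, z r))
      (by rw [hz_eq]; fun_prop) fun _ => hρ
  have hpow (r : ℝ) : r * (2 * m * r ^ (2 * m - 1)) = 2 * m * r ^ (2 * m) := by
    rcases m.eq_zero_or_pos with hm | hm
    · simp [hm]
    · rw [← mul_pow_sub_one (by lia : 2 * m ≠ 0) r]
      ring
  have heuler (r : ℝ) : r * deriv (fun r => F (ρ, s, u, z r)) r = n * F (ρ, s, u, z r) := by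
    have hz' : r • (2 * m * r ^ (2 * m - 1)) • pfaffianVec M = (2 * m : ℝ) • z r := by
      rw [hz_eq, smul_smul, smul_smul, hpow]
    have hcone (c : ℝ) (v : Space n) :
        c • ((0, 0, 0, v) : ℝ × ℝ × Space n × Space n) = (0, 0, 0, c • v) := by simp
    rw [(hasDerivAt_slice hT.contDiffOn hρ u (hzd r)).deriv, ← smul_eq_mul r, ← map_smul, hcone,
      hz', ← hcone, map_smul, smul_eq_mul]
    exact hT.euler_homogeneity contDiff_pfaffianVec pfaffianVec_smul hP hΘ hflux hρ u
      fun i j => by simp [hM i j]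
  have hodd := eq_mul_pow_of_mul_deriv_eq hk heuler (-1)
  rw [hn.neg_one_pow, hz] at hodd
  simp only [even_two.neg_one_pow, one_pow, one_smul] at hodd
  linarith

variable {κ : Type*} [Fintype κ] {e : κ × Bool ≃ Fin n}
  {F : ℝ × ℝ × Space n × ℝ → ℝ}

theorem IsVorticityDensity.apply_eq_mul [Nonempty κ]
    (hT : IsVorticityDensity (IsConstEntropyAt s) (pfaffian e) F (totalDiv Θ))
    (hP : IsEquationOfState P) (hΘ : IsLocalVector (IsConstEntropyAt s) Θ)
    (hflux : HasZeroMovingFlux P (IsConstEntropyAt s) (totalDiv Θ)) (hρ : 0 < ρ) (u : Space n)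
    (w : ℝ) : F (ρ, s, u, w) = F (1, s, u, 1) * w := by
  classical
  have hcard : n = 2 * Fintype.card κ := by
    simpa [mul_comm, eq_comm] using Fintype.card_congr e
  have hn : (n : ℝ) = 2 * Fintype.card κ := by exact_mod_cast hcard
  have hn0 : (n : ℝ) ≠ 0 := by rw [hn]; positivity
  have hk : ContDiff ℝ ∞ fun r => F (1, s, u, r) :=
    hT.contDiffOn.comp_contDiff (f := fun r : ℝ => ((1 : ℝ), s, u, r)) (by fun_prop)
      fun _ => one_pos (α := ℝ)
  have heuler (r : ℝ) : r * deriv (fun r => F (1, s, u, r)) r = (1 : ℕ) * F (1, s, u, r) := by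
    obtain ⟨M, hM, rfl⟩ := exists_pfaffian_eq e r
    have h := hT.euler_homogeneity (contDiff_pfaffian e) (pfaffian_smul e) hP hΘ hflux one_pos u hM
    rw [← hn] at h
    rw [(hasDerivAt_slice hT.contDiffOn one_pos u (hasDerivAt_id' _)).deriv, ← smul_eq_mul,
      ← map_smul, Nat.cast_one, one_mul, ← mul_left_cancel₀ hn0 h]
    simp
  obtain ⟨M, hM, rfl⟩ := exists_pfaffian_eq e w
  rw [hT.apply_eq_apply_one (contDiff_pfaffian e) hΘ hρ u hM]
  simpa using eq_mul_pow_of_mul_deriv_eq hk heuler (pfaffian e M)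

theorem exists_antisymmPart_eq_and_dotProduct_eq {W : Space n} (hW : W ≠ 0)
    (hM : ∀ i j, M j i = -M i j) (w : Space n) :
    ∃ A : Fin n → Fin n → ℝ, antisymmPart A = M ∧ ∀ i, A i ⬝ᵥ W = w i := by
  set c : Space n := (W ⬝ᵥ W)⁻¹ • W with hc
  have hcW : c ⬝ᵥ W = 1 := by
    rw [hc, smul_dotProduct, smul_eq_mul, inv_mul_cancel₀ (dotProduct_self_eq_zero.not.2 hW)]
  set v : Space n := fun i => w i - M i ⬝ᵥ W
  refine ⟨fun i => M i + (c i • v + v i • c - (v ⬝ᵥ W * c i) • c), ?_, fun i => ?_⟩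
  · funext i j
    simp only [antisymmPart, Pi.add_apply, Pi.sub_apply, Pi.smul_apply, smul_eq_mul, hM i j]
    ring
  · simp only [add_dotProduct, sub_dotProduct, smul_dotProduct, hcW, smul_eq_mul, v]
    ring

/-- The vector `W` such that a perturbation `φ a` of the velocity varies the vorticity scalar,
at vorticity `M`, by the derivative `W·∇φ`. -/
def pfaffianFlux (e : κ × Bool ≃ Fin n) (M : Fin n → Fin n → ℝ) (a : Space n) : Space n :=
  fun i => fderiv ℝ (pfaffian e) M ((2⁻¹ : ℝ) • wedge a (Pi.single i 1))

theorem fderiv_pfaffian_wedge_grad (a : Space n) (φ : Space n → ℝ) (x : Space n) :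
    fderiv ℝ (pfaffian e) M ((2⁻¹ : ℝ) • wedge a (grad φ x)) =
      fderiv ℝ φ x (pfaffianFlux e M a) := by
  have hwedge : (2⁻¹ : ℝ) • wedge a (grad φ x) =
      ∑ i, grad φ x i • (2⁻¹ : ℝ) • wedge a (Pi.single i 1) := by
    ext j k
    rw [Finset.sum_apply, Finset.sum_apply]
    simp only [wedge, Pi.smul_apply, smul_eq_mul, Pi.single_apply, mul_sub, mul_ite, mul_one,
      mul_zero, Finset.sum_sub_distrib, Finset.sum_ite_eq, Finset.mem_univ, if_true]
    ring
  rw [hwedge, map_sum, fderiv_apply_eq_sum]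
  exact Finset.sum_congr rfl fun i _ => by
    rw [map_smul, pfaffianFlux, smul_eq_mul, smul_eq_mul, mul_comm, grad, partialDeriv]

theorem pfaffianFlux_blockForm_ne_zero [DecidableEq κ] (k : κ) :
    pfaffianFlux e (blockForm e (Function.update 1 k 0)) (Pi.single (e (k, false)) 1) ≠ 0 := by
  refine Function.ne_iff.2 ⟨e (k, true), ?_⟩
  rw [pfaffianFlux, ← blockForm_single, map_smul, fderiv_pfaffian_blockForm]
  exact mul_ne_zero (by norm_num) (pfaffian_blockForm_one_pos e).ne'

theorem fderiv_velocity_mul_scalar {b : Space n → ℝ} {v : Space n}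
    (hb : DifferentiableAt ℝ b v) (ρ s r r' : ℝ) (v' : Space n) (z : ℝ) :
    fderiv ℝ (fun q : ℝ × ℝ × Space n × ℝ => b q.2.2.1 * q.2.2.2) (ρ, s, v, 0) (r, r', v', z) =
      b v * z := by
  have hq := hasFDerivAt_id (𝕜 := ℝ) ((ρ, s, v, 0) : ℝ × ℝ × Space n × ℝ)
  have hbv := hb.hasFDerivAt.comp (ρ, s, v, (0 : ℝ)) hq.snd.snd.fst
  exact (DFunLike.congr_fun (hbv.mul hq.snd.snd.snd).fderiv _).trans (by simp)

/-- With vanishing vorticity scalar, only the variation of the vorticity scalar contributes to the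
variation of `b(u) ϖ`; the linear flow is free to transport its direction to any given vector. -/
theorem IsVorticityDensity.eq_of_velocity_mul_pfaffian [Nonempty κ] {b : Space n → ℝ}
    (hb : ContDiff ℝ ∞ b)
    (hT : IsVorticityDensity (IsConstEntropyAt s) (pfaffian e) (fun q => b q.2.2.1 * q.2.2.2)
      (totalDiv Θ)) (hΘ : IsLocalVector (IsConstEntropyAt s) Θ) (u v : Space n) : b u = b v := by
  classical
  refine is_const_of_fderiv_eq_zero (hb.differentiable (by simp)) (fun u => ?_) u v
  ext1 w
  obtain ⟨k⟩ := ‹Nonempty κ›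
  set M := blockForm e (Function.update 1 k 0)
  set a : Space n := Pi.single (e (k, false)) 1
  have hM : pfaffian e M = 0 := by
    rw [pfaffian_blockForm, Finset.prod_eq_zero (Finset.mem_univ k) (by simp), zero_mul]
  obtain ⟨A, hAM, hAw⟩ := exists_antisymmPart_eq_and_dotProduct_eq (M := M)
    (pfaffianFlux_blockForm_ne_zero k) (blockForm_antisymm e _) w
  set U := affineField (u, 1, s) A 0 0 with hU
  have hvel : ContDiff ℝ ∞ (velocity U) := contDiff_affineField.fst
  have hzero := fderiv_apply_eq_zero_of_forall_integral_mul_fderiv_eq_zero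
    (μ := MeasureTheory.volume) (g := fun x => b (velocity U x)) (v := pfaffianFlux e M a)
    ((hb.comp hvel).of_le (by exact_mod_cast le_top)) fun φ hφ hφc => by
      have h := hT.integral_affineField_eq_zero (contDiff_pfaffian e) (.inr ⟨s, rfl⟩) hΘ hφ hφc
        (eventually_isConstEntropyAt_affineField_add (p := (u, 1, s)) (v := (a, 0, 0)) one_pos A
          rfl hφ hφc)
      simpa only [hAM, hM, fderiv_velocity_mul_scalar (hb.differentiable (by simp) _),
        fderiv_pfaffian_wedge_grad] using h
  have hvel0 : velocity U 0 = u := by rw [velocity, hU, affineField_zero]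
  have hderiv : fderiv ℝ (velocity U) 0 (pfaffianFlux e M a) = w := by
    funext i
    rw [fderiv_apply_eq_jacobian (hvel.differentiable (by simp) 0), hU,
      jacobian_velocity_affineField]
    exact hAw i
  have h := hzero 0
  rw [fderiv_fun_comp 0 (hb.differentiable (by simp) _) (hvel.differentiable (by simp) 0)] at h
  rwa [ContinuousLinearMap.comp_apply, hderiv, hvel0] at h

theorem IsVorticityDensity.apply_eq_const_mul [Nonempty κ]
    (hT : IsVorticityDensity (IsConstEntropyAt s) (pfaffian e) F (totalDiv Θ))
    (hP : IsEquationOfState P) (hΘ : IsLocalVector (IsConstEntropyAt s) Θ)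
    (hflux : HasZeroMovingFlux P (IsConstEntropyAt s) (totalDiv Θ)) (hρ : 0 < ρ) (u : Space n)
    (w : ℝ) : F (ρ, s, u, w) = F (1, s, 0, 1) * w := by
  have hb : ContDiff ℝ ∞ fun u => F (1, s, u, 1) :=
    hT.contDiffOn.comp_contDiff (f := fun u : Space n => ((1 : ℝ), s, u, (1 : ℝ))) (by fun_prop)
      fun _ => one_pos (α := ℝ)
  have hTb : IsVorticityDensity (IsConstEntropyAt s) (pfaffian e)
      (fun q => F (1, s, q.2.2.1, 1) * q.2.2.2) (totalDiv Θ) := by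
    refine ⟨((hb.comp contDiff_snd.snd.fst).mul contDiff_snd.snd.snd).contDiffOn,
      fun t U x hU => ?_⟩
    rw [hT.apply_eq t U x hU, state, hU.2.self_of_nhds]
    exact hT.apply_eq_mul hP hΘ hflux hU.1.2 _ _
  rw [hT.apply_eq_mul hP hΘ hflux hρ, hTb.eq_of_velocity_mul_pfaffian hb hΘ u 0]

theorem IsVorticityDensity.apply_entropy_eq [Nonempty κ]
    (hT : IsVorticityDensity IsRegularAt (pfaffian e) F (totalDiv Θ))
    (hΘ : IsLocalVector IsRegularAt Θ) (hρ : 0 < ρ) (u : Space n) (w s s' : ℝ) :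
    F (ρ, s, u, w) = F (ρ, s', u, w) := by
  obtain ⟨M, hM, rfl⟩ := exists_pfaffian_eq e w
  have hd (s : ℝ) : HasDerivAt (fun s => F (ρ, s, u, pfaffian e M)) 0 s :=
    hT.fderiv_entropy_eq_zero (contDiff_pfaffian e) hΘ hρ s u hM ▸
      (hasFDerivAt_of_contDiffOn_pos_fst hT.contDiffOn
        (q := (ρ, s, u, pfaffian e M)) hρ).comp_hasDerivAt s
        ((hasDerivAt_const s ρ).prodMk ((hasDerivAt_id s).prodMk (hasDerivAt_const s _)))
  exact is_const_of_deriv_eq_zero (fun s => (hd s).differentiableAt) (fun s => (hd s).deriv) s s'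

end Classification

/-! ### The generalized circulation -/

section Circulation

open Equiv

variable {U : Fields n} {x : Space n} {P : ℝ → ℝ → ℝ} {𝒜 : Fields n → Space n → Prop}

theorem sum_sign_mul_eq_zero {α : Type*} [Fintype α] [DecidableEq α] {f : Perm α → ℝ} {p q : α}
    (hpq : p ≠ q) (hf : ∀ σ, f (σ * swap p q) = f σ) :
    ∑ σ, ((Perm.sign σ : ℤ) : ℝ) * f σ = 0 := by
  have h := Equiv.sum_comp (Equiv.mulRight (swap p q)) fun σ => ((Perm.sign σ : ℤ) : ℝ) * f σ
  simp only [coe_mulRight, hf, Perm.sign_mul, Perm.sign_swap hpq, mul_neg, mul_one,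
    Units.val_neg, Int.cast_neg, neg_mul, Finset.sum_neg_distrib] at h
  linarith

theorem partialDeriv_prod {ι : Type*} [DecidableEq ι] {s : Finset ι} {f : ι → Space n → ℝ}
    (hf : ∀ k ∈ s, DifferentiableAt ℝ (f k) x) (i : Fin n) :
    partialDeriv i (fun y => ∏ k ∈ s, f k y) x =
      ∑ k ∈ s, partialDeriv i (f k) x * ∏ l ∈ s.erase k, f l x := by
  rw [partialDeriv_of_hasFDerivAt (HasFDerivAt.finsetProd fun k hk => (hf k hk).hasFDerivAt)]
  simp [partialDeriv, mul_comm]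

/-- The closedness of the vorticity two-form, contracted with the orientation tensor. -/
theorem sum_sign_mul_partialDeriv_curl_eq_zero (hU : ContDiffAt ℝ ∞ U x) {p q r : Fin n}
    (hpq : p ≠ q) (hpr : p ≠ r) (hqr : q ≠ r) {f : Perm (Fin n) → ℝ}
    (hfq : ∀ σ, f (σ * swap p q) = f σ) (hfr : ∀ σ, f (σ * swap p r) = f σ) :
    ∑ σ : Perm (Fin n), ((Perm.sign σ : ℤ) : ℝ) *
      (partialDeriv (σ p) (fun y => curl U y (σ q) (σ r)) x * f σ) = 0 := by
  have hvel (i) := contDiffAt_pi.1 (contDiffAt_velocity hU) i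
  have hr := sum_sign_mul_eq_zero (f := fun σ : Perm (Fin n) =>
    partialDeriv (σ p) (partialDeriv (σ r) fun y => velocity U y (σ q)) x * f σ) hpr fun σ => by
      simp only [hfr, Perm.mul_apply, swap_apply_left, swap_apply_right,
        swap_apply_of_ne_of_ne hpq.symm hqr]
      rw [partialDeriv_comm (hvel _)]
  have hq := sum_sign_mul_eq_zero (f := fun σ : Perm (Fin n) =>
    partialDeriv (σ p) (partialDeriv (σ q) fun y => velocity U y (σ r)) x * f σ) hpq fun σ => by
      simp only [hfq, Perm.mul_apply, swap_apply_left, swap_apply_right,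
        swap_apply_of_ne_of_ne hpr.symm hqr.symm]
      rw [partialDeriv_comm (hvel _)]
  rw [← mul_zero (2⁻¹ : ℝ), ← sub_self (0 : ℝ)]
  nth_rewrite 1 [← hr]
  rw [← hq, ← Finset.sum_sub_distrib, Finset.mul_sum]
  refine Finset.sum_congr rfl fun σ _ => ?_
  rw [partialDeriv_curl hU]
  ring

theorem sum_sign_mul_partialDeriv_velocity {p q : Fin n} (hpq : p ≠ q) {f : Perm (Fin n) → ℝ}
    (hf : ∀ σ, f (σ * swap p q) = f σ) :
    ∑ σ : Perm (Fin n), ((Perm.sign σ : ℤ) : ℝ) *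
        (f σ * partialDeriv (σ p) (fun y => velocity U y (σ q)) x) =
      -∑ σ : Perm (Fin n), ((Perm.sign σ : ℤ) : ℝ) * (curl U x (σ p) (σ q) * f σ) := by
  have hsymm := sum_sign_mul_eq_zero (f := fun σ : Perm (Fin n) => f σ *
    (partialDeriv (σ p) (fun y => velocity U y (σ q)) x +
      partialDeriv (σ q) (fun y => velocity U y (σ p)) x)) hpq fun σ => by
    simp only [hf, Perm.mul_apply, swap_apply_left, swap_apply_right, add_comm]
  rw [eq_neg_iff_add_eq_zero, ← Finset.sum_add_distrib, ← mul_zero (2⁻¹ : ℝ), ← hsymm,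
    Finset.mul_sum]
  refine Finset.sum_congr rfl fun σ _ => ?_
  rw [curl]
  ring

/-- The position `2k + 2` of the first index of the `k`-th vorticity factor in the
vorticity tensor. -/
def tensorFst (k : Fin ((n - 2) / 2)) : Fin n := ⟨2 * k.1 + 2, by lia⟩

/-- The position `2k + 3` of the second index of the `k`-th vorticity factor in the
vorticity tensor. -/
def tensorSnd (k : Fin ((n - 2) / 2)) : Fin n := ⟨2 * k.1 + 3, by lia⟩

theorem ne_tensorFst_and_ne_tensorSnd {p : Fin n} (hp : p.1 < 2) (k : Fin ((n - 2) / 2)) :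
    p ≠ tensorFst k ∧ p ≠ tensorSnd k := by
  simp only [tensorFst, tensorSnd, ne_eq, Fin.ext_iff]
  lia

/-- The part `∏ₖ M_{σ(2k+2) σ(2k+3)}`, `k ∈ s`, of the product of the vorticity factors in the
summand of the vorticity tensor given by the permutation `σ`. -/
def tensorProd (s : Finset (Fin ((n - 2) / 2))) (M : Fin n → Fin n → ℝ) (σ : Perm (Fin n)) : ℝ :=
  ∏ k ∈ s, M (σ (tensorFst k)) (σ (tensorSnd k))

theorem tensorProd_mul_swap {s : Finset (Fin ((n - 2) / 2))} {p q : Fin n}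
    (hp : ∀ k ∈ s, p ≠ tensorFst k ∧ p ≠ tensorSnd k)
    (hq : ∀ k ∈ s, q ≠ tensorFst k ∧ q ≠ tensorSnd k) (M : Fin n → Fin n → ℝ)
    (σ : Perm (Fin n)) : tensorProd s M (σ * swap p q) = tensorProd s M σ :=
  Finset.prod_congr rfl fun k hk => by
    rw [Perm.mul_apply, Perm.mul_apply,
      swap_apply_of_ne_of_ne (hp k hk).1.symm (hq k hk).1.symm,
      swap_apply_of_ne_of_ne (hp k hk).2.symm (hq k hk).2.symm]

theorem differentiableAt_tensorProd_curl (hU : ContDiffAt ℝ ∞ U x)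
    (s : Finset (Fin ((n - 2) / 2))) (σ : Perm (Fin n)) :
    DifferentiableAt ℝ (fun y => tensorProd s (curl U y) σ) x := by
  have hcurl (i j) := contDiffAt_pi.1 (contDiffAt_pi.1 (contDiffAt_curl hU) i) j
  exact (contDiffAt_prod fun k _ => hcurl _ _).differentiableAt (by simp)

theorem partialDeriv_tensorProd_curl (hU : ContDiffAt ℝ ∞ U x) (σ : Perm (Fin n)) (i : Fin n) :
    partialDeriv i (fun y => tensorProd Finset.univ (curl U y) σ) x =
      ∑ k, partialDeriv i (fun y => curl U y (σ (tensorFst k)) (σ (tensorSnd k))) x *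
        tensorProd (Finset.univ.erase k) (curl U x) σ := by
  have hcurl (i j) := contDiffAt_pi.1 (contDiffAt_pi.1 (contDiffAt_curl hU) i) j
  exact partialDeriv_prod (fun k _ => (hcurl _ _).differentiableAt (by simp)) i

theorem vorticityScalar_eq_sum_tensorProd {p q : Fin n} (hp : p.1 = 0) (hq : q.1 = 1)
    (U : Fields n) (x : Space n) :
    vorticityScalar U x = ∑ σ : Perm (Fin n), ((Perm.sign σ : ℤ) : ℝ) *
      (curl U x (σ p) (σ q) * tensorProd Finset.univ (curl U x) σ) := by
  have hn : 1 < n := hq ▸ q.2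
  have hdim : (n - 2) / 2 + 1 = n / 2 := by lia
  obtain rfl : p = ⟨0, one_pos.trans hn⟩ := Fin.ext hp
  obtain rfl : q = ⟨1, hn⟩ := Fin.ext hq
  refine Finset.sum_congr rfl fun σ _ => ?_
  rw [← (finCongr hdim).prod_comp, Fin.prod_univ_succ]
  rfl

theorem circulation_apply_eq_sum_tensorProd {p q : Fin n} (hp : p.1 = 0) (hq : q.1 = 1) (t : ℝ)
    (U : Fields n) (x : Space n) (i : Fin n) :
    circulation t U x i = ∑ σ : Perm (Fin n) with σ p = i, ((Perm.sign σ : ℤ) : ℝ) *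
      (tensorProd Finset.univ (curl U x) σ * velocity U x (σ q)) := by
  have hsymm (σ : Perm (Fin n)) (i j : Fin n) : (σ.symm i).1 = j.1 ↔ σ j = i := by
    rw [← Fin.ext_iff, symm_apply_eq, eq_comm]
  simp only [circulation, vorticityTensor, ← hp, ← hq, hsymm, ← Finset.filter_filter,
    Finset.sum_mul]
  rw [← Finset.sum_fiberwise _ fun σ : Perm (Fin n) => σ q]
  refine Finset.sum_congr rfl fun j _ => Finset.sum_congr rfl fun σ hσ => ?_
  rw [(Finset.mem_filter.1 hσ).2, mul_assoc]
  rfl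

theorem totalDiv_circulation_eq_sum {p q : Fin n} (hp : p.1 = 0) (hq : q.1 = 1) (t : ℝ)
    (hU : ContDiffAt ℝ ∞ U x) :
    totalDiv circulation t U x = ∑ σ : Perm (Fin n), ((Perm.sign σ : ℤ) : ℝ) *
      partialDeriv (σ p) (fun y => tensorProd Finset.univ (curl U y) σ * velocity U y (σ q)) x := by
  have hterm (σ : Perm (Fin n)) : DifferentiableAt ℝ
      (fun y => tensorProd Finset.univ (curl U y) σ * velocity U y (σ q)) x :=
    (differentiableAt_tensorProd_curl hU _ σ).mul
      ((contDiffAt_pi.1 (contDiffAt_velocity hU) _).differentiableAt (by simp))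
  rw [totalDiv, divergence, ← Finset.sum_fiberwise _ fun σ : Perm (Fin n) => σ p]
  refine Finset.sum_congr rfl fun i _ => ?_
  simp only [circulation_apply_eq_sum_tensorProd hp hq]
  rw [partialDeriv_sum fun σ _ => (hterm σ).const_mul _]
  refine Finset.sum_congr rfl fun σ hσ => ?_
  rw [partialDeriv_const_mul (hterm σ), (Finset.mem_filter.1 hσ).2]

theorem sum_sign_mul_partialDeriv_curl_mul_tensorProd_erase_eq_zero (hU : ContDiffAt ℝ ∞ U x)
    {p q : Fin n} (hp : p.1 < 2) (hq : q.1 < 2) (hpq : p ≠ q) (k : Fin ((n - 2) / 2)) :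
    ∑ σ : Perm (Fin n), ((Perm.sign σ : ℤ) : ℝ) *
      (partialDeriv (σ p) (fun y => curl U y (σ (tensorFst k)) (σ (tensorSnd k))) x *
        (tensorProd (Finset.univ.erase k) (curl U x) σ * velocity U x (σ q))) = 0 := by
  have hinvariant (r : Fin n) (hr : r = tensorFst k ∨ r = tensorSnd k) (σ : Perm (Fin n)) :
      tensorProd (Finset.univ.erase k) (curl U x) (σ * swap p r) *
          velocity U x ((σ * swap p r) q) =
        tensorProd (Finset.univ.erase k) (curl U x) σ * velocity U x (σ q) := by
    have hqr : q ≠ r := by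
      rintro rfl
      rcases hr with rfl | rfl <;> simp [tensorFst, tensorSnd] at hq
    rw [tensorProd_mul_swap (fun l _ => ne_tensorFst_and_ne_tensorSnd hp l) (fun l hl => ?_),
      Perm.mul_apply, swap_apply_of_ne_of_ne hpq.symm hqr]
    have hlk : l.1 ≠ k.1 := Fin.val_ne_of_ne (Finset.ne_of_mem_erase hl)
    rcases hr with rfl | rfl <;> simp only [tensorFst, tensorSnd, ne_eq, Fin.ext_iff] <;> lia
  exact sum_sign_mul_partialDeriv_curl_eq_zero hU (ne_tensorFst_and_ne_tensorSnd hp k).1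
    (ne_tensorFst_and_ne_tensorSnd hp k).2 (by simp [tensorFst, tensorSnd])
    (hinvariant _ (.inl rfl)) (hinvariant _ (.inr rfl))

theorem totalDiv_circulation (hn : 1 < n) (t : ℝ) (hU : ContDiffAt ℝ ∞ U x) :
    totalDiv circulation t U x = -vorticityScalar U x := by
  obtain ⟨p, hp⟩ : ∃ p : Fin n, p.1 = 0 := ⟨⟨0, by lia⟩, rfl⟩
  obtain ⟨q, hq⟩ : ∃ q : Fin n, q.1 = 1 := ⟨⟨1, hn⟩, rfl⟩
  have hpq : p ≠ q := Fin.ne_of_val_ne (by lia)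
  have hp2 : p.1 < 2 := by lia
  have hq2 : q.1 < 2 := by lia
  have hproduct (σ : Perm (Fin n)) :=
    partialDeriv_mul (differentiableAt_tensorProd_curl hU Finset.univ σ)
      ((contDiffAt_pi.1 (contDiffAt_velocity hU) (σ q)).differentiableAt (by simp)) (σ p)
  rw [totalDiv_circulation_eq_sum hp hq t hU, vorticityScalar_eq_sum_tensorProd hp hq,
    ← sum_sign_mul_partialDeriv_velocity hpq
      (tensorProd_mul_swap (fun k _ => ne_tensorFst_and_ne_tensorSnd hp2 k)
        (fun k _ => ne_tensorFst_and_ne_tensorSnd hq2 k) _)]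
  simp_rw [hproduct, partialDeriv_tensorProd_curl hU, mul_add, Finset.sum_mul, Finset.mul_sum,
    mul_assoc]
  rw [Finset.sum_add_distrib, Finset.sum_comm (s := Finset.univ (α := Perm (Fin n))),
    Finset.sum_eq_zero fun k _ =>
      sum_sign_mul_partialDeriv_curl_mul_tensorProd_erase_eq_zero hU hp2 hq2 hpq k, add_zero]

/-- The vorticity as a function of the first derivatives of the fields. -/
def curlOfDerivs (D : Derivs n 1) (i j : Fin n) : ℝ :=
  ((D 0 fun _ => Pi.single j 1).1 i - (D 0 fun _ => Pi.single i 1).1 j) / 2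

theorem contDiff_curlOfDerivs : ContDiff ℝ ∞ (curlOfDerivs (n := n)) := by
  have happly (v : Space n) : ContDiff ℝ ∞ fun D : Derivs n 1 => D 0 fun _ => v :=
    (ContinuousMultilinearMap.apply ℝ (fun _ : Fin 1 => Space n) (Phase n) fun _ => v).contDiff.comp
      (ContinuousLinearMap.proj (R := ℝ)
        (φ := fun j : Fin 1 => Space n [×(j.1 + 1)]→L[ℝ] Phase n) 0).contDiff
  have hentry (i j : Fin n) :
      ContDiff ℝ ∞ fun D : Derivs n 1 => (D 0 fun _ => (Pi.single j 1 : Space n)).1 i :=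
    contDiff_pi.1 (happly _).fst i
  exact contDiff_pi.2 fun i => contDiff_pi.2 fun j => ((hentry i j).sub (hentry j i)).div_const 2

theorem curlOfDerivs_iteratedFDeriv (hU : DifferentiableAt ℝ U x) :
    curlOfDerivs (fun j => iteratedFDeriv ℝ (j.1 + 1) U x) = curl U x := by
  have hentry (i j : Fin n) : (iteratedFDeriv ℝ 1 U x fun _ => Pi.single j 1).1 i =
      partialDeriv j (fun y => velocity U y i) x := by
    have hvel : HasFDerivAt (fun y => velocity U y i) _ x := hasFDerivAt_pi'.1 hU.hasFDerivAt.fst i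
    rw [partialDeriv_of_hasFDerivAt hvel, iteratedFDeriv_one_apply]
    rfl
  funext i j
  exact congrArg (· / 2) (congrArg₂ (· - ·) (hentry i j) (hentry j i))

theorem isLocalVector_circulation (h𝒜 : IsFlowClass 𝒜) :
    IsLocalVector 𝒜 (circulation (n := n)) := by
  refine ⟨1, fun q i => ∑ j, (∑ σ : Perm (Fin n) with (σ.symm i).1 = 0 ∧ (σ.symm j).1 = 1,
    ((Perm.sign σ : ℤ) : ℝ) * tensorProd Finset.univ (curlOfDerivs q.2.2.2) σ) * q.2.2.1.1 j,
    ContDiff.contDiffOn ?_, fun t U x hU => ?_⟩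
  · refine contDiff_pi.2 fun i => ContDiff.sum fun j _ => ContDiff.mul (ContDiff.sum fun σ _ =>
      contDiff_const.mul (contDiff_prod fun k _ => ?_)) (by fun_prop)
    exact (contDiff_pi.1 (contDiff_pi.1 contDiff_curlOfDerivs _) _).comp (by fun_prop)
  · simp only [curlOfDerivs_iteratedFDeriv
      ((h𝒜.isRegularAt hU).contDiffAt.differentiableAt (by simp))]
    rfl

theorem exists_vorticityScalar_ne_zero (hn : Even n) (h𝒜 : IsFlowClass 𝒜) :
    ∃ U, 𝒜 U 0 ∧ vorticityScalar U 0 ≠ 0 := by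
  obtain ⟨s, hs⟩ := h𝒜.exists_isConstEntropyAt
  refine ⟨affineField (0, 1, s) (blockForm (pairEquiv hn) 1) 0 0,
    hs _ _ (isConstEntropyAt_affineField (p := (0, 1, s)) one_pos), ?_⟩
  rw [vorticityScalar_eq_pfaffian hn, curl_affineField,
    antisymmPart_eq_self (blockForm_antisymm _ _)]
  exact (pfaffian_blockForm_one_pos _).ne'

theorem isMovingBoundaryCOM_circulation (hn : 1 < n) (he : Even n) (hP : IsEquationOfState P)
    (h𝒜 : IsIsentropicFlow P 𝒜) : IsMovingBoundaryCOM P 𝒜 (circulation (n := n)) := by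
  have hclass := h𝒜.isFlowClass
  have hdiv (t : ℝ) (U : Fields n) (x : Space n) (hU : 𝒜 U x) :=
    totalDiv_circulation hn t (hclass.isRegularAt hU).contDiffAt
  refine ⟨isLocalVector_circulation hclass, ?_, fun t U x hU => ?_⟩
  · obtain ⟨U, hU, hne⟩ := exists_vorticityScalar_ne_zero he hclass
    exact ⟨0, U, 0, hU, hdiv 0 U 0 hU ▸ neg_ne_zero.2 hne⟩
  · rw [movingFlux_const_mul_pfaffian (e := pairEquiv he) (c := -1)
      (fun t U x hU => (hdiv t U x hU).trans (neg_one_mul _).symm) hP hclass t hU,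
      antisymmPart_jacobian_force_of_isIsentropicFlow hP h𝒜 hU, map_zero, mul_zero, neg_zero]

end Circulation

/-! ### Constants of motion of vorticity form -/

section VorticityForm

variable {P : ℝ → ℝ → ℝ} {𝒜 : Fields n → Space n → Prop}
  {Θ Ψ : ℝ → Fields n → Space n → Space n} {T : ℝ → Fields n → Space n → ℝ} {U : Fields n}
  {x : Space n}

theorem IsLocalVector.mono {ℬ : Fields n → Space n → Prop} (hΘ : IsLocalVector 𝒜 Θ)
    (h : ∀ U x, ℬ U x → 𝒜 U x) : IsLocalVector ℬ Θ := by
  obtain ⟨k, L, hL, hΘL⟩ := hΘ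
  exact ⟨k, L, hL, fun t U x hU => hΘL t U x (h U x hU)⟩

theorem HasVorticityForm.exists_isVorticityDensity_pfaffian (hT : HasVorticityForm 𝒜 T)
    (he : Even n) : ∃ F, IsVorticityDensity 𝒜 (pfaffian (pairEquiv he)) F T := by
  rcases hT with ⟨-, F, hF, hTF⟩ | ⟨ho, -⟩
  exacts [⟨F, hF, hTF⟩, absurd he (Nat.not_even_iff_odd.2 ho)]

theorem HasVorticityForm.exists_isVorticityDensity_pfaffianVec (hT : HasVorticityForm 𝒜 T)
    (ho : Odd n) : ∃ F, IsVorticityDensity 𝒜 pfaffianVec F T := by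
  rcases hT with ⟨he, -⟩ | ⟨-, F, hF, hTF⟩
  exacts [absurd ho (Nat.not_odd_iff_even.2 he), ⟨F, hF, hTF⟩]

theorem curl_antisymm (U : Fields n) (x : Space n) (i j : Fin n) :
    curl U x j i = -curl U x i j := by
  simp only [curl]
  ring

theorem totalDiv_eq_zero_of_odd (ho : Odd n) (hP : IsEquationOfState P) (h𝒜 : IsFlowClass 𝒜)
    (hΘ : IsLocalVector 𝒜 Θ) (hflux : HasZeroMovingFlux P 𝒜 (totalDiv Θ))
    (hv : HasVorticityForm 𝒜 (totalDiv Θ)) (t : ℝ) (hU : 𝒜 U x) : totalDiv Θ t U x = 0 := by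
  obtain ⟨F, hT⟩ := hv.exists_isVorticityDensity_pfaffianVec ho
  have hsub : ∀ V y, IsConstEntropyAt (entropy U x) V y → 𝒜 V y := by
    rcases h𝒜 with rfl | ⟨s, rfl⟩
    · exact fun V y hV => hV.1
    · exact fun V y hV => hU.2.self_of_nhds ▸ hV
  rw [hT.apply_eq t U x hU]
  exact (hT.mono hsub).apply_eq_zero_of_odd ho hP (hΘ.mono hsub)
    (fun t V y hV => hflux t V y (hsub V y hV)) (h𝒜.isRegularAt hU).2 _ (curl_antisymm U x)

theorem exists_totalDiv_eq_mul_vorticityScalar (hn : 1 < n) (he : Even n)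
    (hP : IsEquationOfState P) (h𝒜 : IsFlowClass 𝒜) (hΘ : IsLocalVector 𝒜 Θ)
    (hflux : HasZeroMovingFlux P 𝒜 (totalDiv Θ)) (hv : HasVorticityForm 𝒜 (totalDiv Θ)) :
    ∃ c : ℝ, ∀ t U x, 𝒜 U x → totalDiv Θ t U x = c * vorticityScalar U x := by
  have : Nonempty (Fin (n / 2)) := ⟨⟨0, by lia⟩⟩
  obtain ⟨F, hT⟩ := hv.exists_isVorticityDensity_pfaffian he
  rcases h𝒜 with rfl | ⟨s, rfl⟩
  · have hsub : ∀ (V : Fields n) y, IsConstEntropyAt 0 V y → IsRegularAt V y := fun _ _ hV => hV.1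
    refine ⟨F (1, 0, 0, 1), fun t U x hU => ?_⟩
    rw [hT.apply_eq t U x hU, state, hT.apply_entropy_eq hΘ hU.2 _ _ _ 0]
    exact (hT.mono hsub).apply_eq_const_mul hP (hΘ.mono hsub)
      (fun t V y hV => hflux t V y (hsub V y hV)) hU.2 _ _
  · refine ⟨F (1, s, 0, 1), fun t U x hU => ?_⟩
    rw [hT.apply_eq t U x hU, state, hU.2.self_of_nhds]
    exact hT.apply_eq_const_mul hP hΘ hflux hU.1.2 _ _

theorem hasVorticityForm_circulation (hn : 1 < n) (he : Even n) (h𝒜 : IsFlowClass 𝒜) :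
    HasVorticityForm 𝒜 (totalDiv circulation) :=
  .inl ⟨he, fun q => -q.2.2.2, by fun_prop, fun t _ _ hU =>
    totalDiv_circulation hn t (h𝒜.isRegularAt hU).contDiffAt⟩

theorem totalDiv_sub_smul (h𝒜 : IsFlowClass 𝒜) (hΘ : IsLocalVector 𝒜 Θ) (hΨ : IsLocalVector 𝒜 Ψ)
    (c t : ℝ) (hU : 𝒜 U x) :
    totalDiv (fun t U x => Θ t U x - c • Ψ t U x) t U x =
      totalDiv Θ t U x - c * totalDiv Ψ t U x := by
  have hdΘ := (hΘ.contDiffAt h𝒜 hU t).differentiableAt (n := ∞) (by simp)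
  have hdΨ := (hΨ.contDiffAt h𝒜 hU t).differentiableAt (n := ∞) (by simp)
  refine (divergence_sub hdΘ (hdΨ.const_smul c)).trans (congrArg _ ?_)
  refine (divergence_smul (differentiableAt_const c) hdΨ).trans ?_
  rw [fderiv_fun_const, Pi.zero_apply, _root_.zero_apply, zero_add]
  rfl

end VorticityForm

end Fluid

end

theorem proposition3 (n : ℕ) (hn : 1 < n) (P : ℝ → ℝ → ℝ) (hP : Fluid.IsEquationOfState P) :
    (Fluid.IsNonisentropic P →
      ¬ ∃ Θ : ℝ → Fluid.Fields n → Fluid.Space n → Fluid.Space n,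
        Fluid.IsMovingBoundaryCOM P Fluid.IsRegularAt Θ ∧
          Fluid.HasVorticityForm Fluid.IsRegularAt (Fluid.totalDiv Θ)) ∧
    (∀ 𝒜 : Fluid.Fields n → Fluid.Space n → Prop, Fluid.IsIsentropicFlow P 𝒜 →
      (Even n →
        (Fluid.IsMovingBoundaryCOM P 𝒜 Fluid.circulation ∧
          Fluid.HasVorticityForm 𝒜 (Fluid.totalDiv Fluid.circulation)) ∧
        ∀ Θ : ℝ → Fluid.Fields n → Fluid.Space n → Fluid.Space n,
          Fluid.IsMovingBoundaryCOM P 𝒜 Θ → Fluid.HasVorticityForm 𝒜 (Fluid.totalDiv Θ) →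
            ∃ c : ℝ, c ≠ 0 ∧ ∀ t U x, 𝒜 U x →
              Fluid.totalDiv (fun t U x => Θ t U x - c • Fluid.circulation t U x) t U x = 0) ∧
      (Odd n →
        ¬ ∃ Θ : ℝ → Fluid.Fields n → Fluid.Space n → Fluid.Space n,
          Fluid.IsMovingBoundaryCOM P 𝒜 Θ ∧
            Fluid.HasVorticityForm 𝒜 (Fluid.totalDiv Θ))) := by
  refine ⟨?_, fun 𝒜 h𝒜 => ⟨fun he => ⟨⟨?_, ?_⟩, ?_⟩, ?_⟩⟩
  · rintro hS ⟨Θ, ⟨hΘ, ⟨t, U, x, hU, hne⟩, hflux⟩, hv⟩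
    rcases Nat.even_or_odd n with he | ho
    · have : Nonempty (Fin (n / 2)) := ⟨⟨0, by lia⟩⟩
      obtain ⟨c, hc⟩ :=
        Fluid.exists_totalDiv_eq_mul_vorticityScalar hn he hP (.inl rfl) hΘ hflux hv
      have hc0 : c = 0 := Fluid.eq_zero_of_isNonisentropic (e := Fluid.pairEquiv he) hP hS hc hflux
      exact hne (by rw [hc t U x hU, hc0, zero_mul])
    · exact hne (Fluid.totalDiv_eq_zero_of_odd ho hP (.inl rfl) hΘ hflux hv t hU)
  · exact Fluid.isMovingBoundaryCOM_circulation hn he hP h𝒜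
  · exact Fluid.hasVorticityForm_circulation hn he h𝒜.isFlowClass
  · rintro Θ ⟨hΘ, ⟨t, U, x, hU, hne⟩, hflux⟩ hv
    obtain ⟨c, hc⟩ :=
      Fluid.exists_totalDiv_eq_mul_vorticityScalar hn he hP h𝒜.isFlowClass hΘ hflux hv
    refine ⟨-c, fun hc0 => hne (by rw [hc t U x hU, neg_eq_zero.1 hc0, zero_mul]),
      fun t U x hU => ?_⟩
    rw [Fluid.totalDiv_sub_smul h𝒜.isFlowClass hΘ
      (Fluid.isLocalVector_circulation h𝒜.isFlowClass) (-c) t hU, hc t U x hU,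
      Fluid.totalDiv_circulation hn t (h𝒜.isFlowClass.isRegularAt hU).contDiffAt]
    ring
  · rintro ho ⟨Θ, ⟨hΘ, ⟨t, U, x, hU, hne⟩, hflux⟩, hv⟩
    exact hne (Fluid.totalDiv_eq_zero_of_odd ho hP h𝒜.isFlowClass hΘ hflux hv t hU)
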